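/- Let $\mathsf{ACA}_0^\omega=\mathsf{RCA}_0^\omega+(\exists^2)$, where $\mathsf{RCA}_0^\omega$ is Kohlenbach's base theory of higher-order reverse mathematics, i.e. the classical theory in the language of all finite types with the following axioms: $0,1,<,+,\times$ form an ordered semiring; the defining axioms of the combinators $\Pi,\Sigma$ and of the recursor $R_0$; extensionality at all types; induction for quantifier-free formulas; and quantifier-free choice $\mathsf{QF\text{-}AC}^{1,0}$. The axiom $(\exists^2)$ states that there is $\varphi:\mathbb N^{\mathbb N}\to\{0,1\}$ such that $\varphi(f)=0\leftrightarrow(\exists n)(f(n)=0)$ for all $f\in\mathbb N^{\mathbb N}$. Real numbers are fast-converging Cauchy sequences $(q_n)$ of rationals ($|q_n-q_{n+i}|<2^{-n}$), functions $[0,1]\to\mathbb R$ are type $1\to1$ objects respecting equality of reals, and subsets of $[0,1]$ are given only by characteristic functions respecting equality of reals. Balls, open sets and dense sets are relative to $[0,1]$. **Theorem.** The following are equivalent over $\mathsf{ACA}_0^\omega$ (that is, in every model of $\mathsf{ACA}_0^\omega$ either all of them hold or none does; by Gödel's completeness theorem, this says that $\mathsf{ACA}_0^\omega$ proves their equivalence).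 (a) $\mathsf{BCT}_{[0,1]}$: if $(O_n)_{n\in\mathbb N}$ is a decreasing sequence of dense open subsets of $[0,1]$, then $\bigcap_{n}O_n\neq\emptyset$. (b) Every upper semi-continuous (usco) $f:[0,1]\to\mathbb R$ is continuous at some $x\in[0,1]$. (c) Every usco $f:[0,1]\to\mathbb R$ which has an oscillation function $\mathsf{osc}_f:[0,1]\to\mathbb R$ is continuous at some $x\in[0,1]$. (d) Every usco $f:[0,1]\to\mathbb R$ which is its own oscillation function is continuous at some $x\in[0,1]$. (e) Every usco and countably continuous $f:[0,1]\to\mathbb R$ is continuous at some $x\in[0,1]$. (f) Every usco $f:[0,1]\to\mathbb R$ is bounded below on some interval: there are $q\in\mathbb Q$ and $c,d\in[0,1]$ with $c<d$ such that $f(y)\ge q$ for all $y\in(c,d)$. (g) For every usco $f:[0,1]\to\mathbb R$ with $f(x)>0$ for all $x\in[0,1]$, there are $c,d\in[0,1]$ with $c<d$ and $0<\inf_{x\in[c,d]}f(x)$. Here $f$ is usco if for all $x\in[0,1]$ and $k\in\mathbb N$ there is $N\in\mathbb N$ such that $f(y)<f(x)+2^{-k}$ for all $y\in[0,1]$ with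 $|x-y|<2^{-N}$. The function $g:[0,1]\to\mathbb R$ is the oscillation function of $f$ if for all $x\in[0,1]$, $g(x)=\lim_{k\to\infty}\big(\sup_{B(x,2^{-k})}f-\inf_{B(x,2^{-k})}f\big)$. The function $f$ is countably continuous if there is a sequence $(E_n)_{n\in\mathbb N}$ of sets with $[0,1]=\bigcup_nE_n$ such that the restriction of $f$ to each $E_n$ is continuous. Statements involving suprema, infima and limits are shorthand for the usual inequalities between values of $f$ and $g$, and the existence of suprema or infima is not presupposed; e.g. $\inf_{[c,d]}f>0$ means that some $2^{-l}$ is a lower bound of $f$ on $[c,d]$. -/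

import Mathlib

universe u

namespace HigherOrderArithmetic

/-! ## The language of higher-order arithmetic in all finite types -/

/-- The finite types: `nat` is the type `0` of natural numbers, `σ ⟶ₜ τ` is the type of mappings
from objects of type `σ` to objects of type `τ`. -/
inductive FType : Type
  | nat : FType
  | arrow : FType → FType → FType

infixr:60 " ⟶ₜ " => FType.arrow

/-- The type `1 = 0 → 0`. -/
abbrev FType.one : FType := FType.nat ⟶ₜ FType.nat

/-- The type `2 = 1 → 0`. -/
abbrev FType.two : FType := FType.one ⟶ₜ FType.nat

/-- The constants: `0`, `1`, `+`, `×`, the combinators `Π` and `Σ`, the recursors `R_σ`. -/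
inductive Const : FType → Type
  | zero : Const .nat
  | one : Const .nat
  | add : Const (.nat ⟶ₜ .nat ⟶ₜ .nat)
  | mul : Const (.nat ⟶ₜ .nat ⟶ₜ .nat)
  | combPi (ρ τ : FType) : Const (ρ ⟶ₜ τ ⟶ₜ ρ)
  | combSigma (δ ρ τ : FType) : Const ((δ ⟶ₜ ρ ⟶ₜ τ) ⟶ₜ (δ ⟶ₜ ρ) ⟶ₜ δ ⟶ₜ τ)
  | recursor (σ : FType) : Const ((.nat ⟶ₜ σ ⟶ₜ σ) ⟶ₜ σ ⟶ₜ .nat ⟶ₜ σ)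

/-- A variable of type `τ` in the context (list of types of free variables) `Γ`. -/
inductive Var : List FType → FType → Type
  | here {Γ : List FType} {σ : FType} : Var (σ :: Γ) σ
  | there {Γ : List FType} {σ τ : FType} : Var Γ τ → Var (σ :: Γ) τ

/-- Terms of type `τ` with free variables in `Γ`. -/
inductive LTerm (Γ : List FType) : FType → Type
  | var {τ : FType} : Var Γ τ → LTerm Γ τ
  | const {τ : FType} : Const τ → LTerm Γ τ
  | app {σ τ : FType} : LTerm Γ (σ ⟶ₜ τ) → LTerm Γ σ → LTerm Γ τ

/-- Quantifier-free formulas with free variables (of any finite type) in `Γ`.  The prime formulas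
are the equations and inequalities between terms of type `0`. -/
inductive QFFormula (Γ : List FType) : Type
  | eq : LTerm Γ .nat → LTerm Γ .nat → QFFormula Γ
  | lt : LTerm Γ .nat → LTerm Γ .nat → QFFormula Γ
  | neg : QFFormula Γ → QFFormula Γ
  | and : QFFormula Γ → QFFormula Γ → QFFormula Γ
  | or : QFFormula Γ → QFFormula Γ → QFFormula Γ
  | imp : QFFormula Γ → QFFormula Γ → QFFormula Γ

/-- A (many-sorted, first-order, Henkin) structure for the language: an arbitrary domain for each
finite type, with an application operation, an interpretation of the constants and of the relation
`<` on type `0`.  The domain of type `σ ⟶ₜ τ` need not contain all maps, and the domain of type `0`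
need not be the standard natural numbers. -/
structure Structure : Type (u + 1) where
  D : FType → Type u
  app : {σ τ : FType} → D (σ ⟶ₜ τ) → D σ → D τ
  const : {σ : FType} → Const σ → D σ
  lt : D .nat → D .nat → Prop

namespace Structure

variable (M : Structure.{u})

instance : Zero (M.D .nat) := ⟨M.const .zero⟩
instance : One (M.D .nat) := ⟨M.const .one⟩
instance : Add (M.D .nat) := ⟨fun a b => M.app (M.app (M.const .add) a) b⟩
instance : Mul (M.D .nat) := ⟨fun a b => M.app (M.app (M.const .mul) a) b⟩
instance : LT (M.D .nat) := ⟨M.lt⟩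

/-- Assignments of values in `M` to the free variables in a context. -/
def Env : List FType → Type u
  | [] => PUnit
  | σ :: Γ => M.D σ × Env Γ

/-- The value of a variable. -/
def varVal : {Γ : List FType} → {τ : FType} → Var Γ τ → M.Env Γ → M.D τ
  | _, _, .here, e => e.1
  | _, _, .there v, e => varVal v e.2

/-- The value of a term. -/
def termVal {Γ : List FType} (e : M.Env Γ) : {τ : FType} → LTerm Γ τ → M.D τ
  | _, .var v => M.varVal v e
  | _, .const c => M.const c
  | _, .app s t => M.app (termVal e s) (termVal e t)

/-- Truth of a quantifier-free formula. -/
def Sat {Γ : List FType} (e : M.Env Γ) : QFFormula Γ → Prop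
  | .eq s t => M.termVal e s = M.termVal e t
  | .lt s t => M.termVal e s < M.termVal e t
  | .neg A => ¬ Sat e A
  | .and A B => Sat e A ∧ Sat e B
  | .or A B => Sat e A ∨ Sat e B
  | .imp A B => Sat e A → Sat e B

/-- Equality at a finite type, defined from equality at type `0` by applying to all possible
arguments. -/
def EqAt : (τ : FType) → M.D τ → M.D τ → Prop
  | .nat, x, y => x = y
  | .arrow σ τ, x, y => ∀ z : M.D σ, EqAt τ (M.app x z) (M.app y z)

/-! ## The axioms -/

/-- `0, 1, <, +, ×` form a (commutative) ordered semiring. -/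
structure OrderedSemiringAxioms : Prop where
  add_assoc : ∀ a b c : M.D .nat, a + b + c = a + (b + c)
  add_comm : ∀ a b : M.D .nat, a + b = b + a
  add_zero : ∀ a : M.D .nat, a + 0 = a
  mul_assoc : ∀ a b c : M.D .nat, a * b * c = a * (b * c)
  mul_comm : ∀ a b : M.D .nat, a * b = b * a
  mul_one : ∀ a : M.D .nat, a * 1 = a
  mul_zero : ∀ a : M.D .nat, a * 0 = 0
  mul_add : ∀ a b c : M.D .nat, a * (b + c) = a * b + a * c
  lt_irrefl : ∀ a : M.D .nat, ¬ a < a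
  lt_trans : ∀ a b c : M.D .nat, a < b → b < c → a < c
  lt_total : ∀ a b : M.D .nat, a < b ∨ a = b ∨ b < a
  zero_lt_one : (0 : M.D .nat) < 1
  add_lt_add : ∀ a b c : M.D .nat, a < b → a + c < b + c
  mul_lt_mul : ∀ a b c : M.D .nat, a < b → 0 < c → a * c < b * c

/-- `M` is a model of Kohlenbach's base theory `RCA₀^ω`.  (As usual for this theory, only the
recursor `R₀` is axiomatised.) -/
structure ModelsRCA0ω : Prop where
  semiring : M.OrderedSemiringAxioms
  combPi_eq : ∀ (ρ τ : FType) (x : M.D ρ) (y : M.D τ),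
    M.EqAt ρ (M.app (M.app (M.const (.combPi ρ τ)) x) y) x
  combSigma_eq : ∀ (δ ρ τ : FType) (x : M.D (δ ⟶ₜ ρ ⟶ₜ τ)) (y : M.D (δ ⟶ₜ ρ)) (z : M.D δ),
    M.EqAt τ (M.app (M.app (M.app (M.const (.combSigma δ ρ τ)) x) y) z)
      (M.app (M.app x z) (M.app y z))
  recursor_zero : ∀ (f : M.D (.nat ⟶ₜ .nat ⟶ₜ .nat)) (m : M.D .nat),
    M.app (M.app (M.app (M.const (.recursor .nat)) f) m) 0 = m
  recursor_succ : ∀ (f : M.D (.nat ⟶ₜ .nat ⟶ₜ .nat)) (m n : M.D .nat),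
    M.app (M.app (M.app (M.const (.recursor .nat)) f) m) (n + 1) =
      M.app (M.app f n) (M.app (M.app (M.app (M.const (.recursor .nat)) f) m) n)
  extensionality : ∀ (ρ τ : FType) (x y : M.D ρ) (φ : M.D (ρ ⟶ₜ τ)),
    M.EqAt ρ x y → M.EqAt τ (M.app φ x) (M.app φ y)
  qf_induction : ∀ (Γ : List FType) (A : QFFormula (.nat :: Γ)) (e : M.Env Γ),
    M.Sat (Γ := .nat :: Γ) (0, e) A →
    (∀ n : M.D .nat, M.Sat (Γ := .nat :: Γ) (n, e) A → M.Sat (Γ := .nat :: Γ) (n + 1, e) A) →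
    ∀ n : M.D .nat, M.Sat (Γ := .nat :: Γ) (n, e) A
  qf_choice : ∀ (Γ : List FType) (A : QFFormula (.nat :: .one :: Γ)) (e : M.Env Γ),
    (∀ x : M.D .one, ∃ y : M.D .nat, M.Sat (Γ := .nat :: .one :: Γ) (y, x, e) A) →
    ∃ Y : M.D .two, ∀ x : M.D .one, M.Sat (Γ := .nat :: .one :: Γ) (M.app Y x, x, e) A

/-- `M` is a model of `ACA₀^ω`, i.e. of `RCA₀^ω` plus the axiom `(∃²)`. -/
structure ModelsACA0ω : Prop extends M.ModelsRCA0ω where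
  exists_two : ∃ φ : M.D .two, ∀ f : M.D .one,
    (M.app φ f = 0 ∨ M.app φ f = 1) ∧ ((∃ n : M.D .nat, M.app f n = 0) ↔ M.app φ f = 0)

/-! ## Rational numbers

All quantifiers below range over the domains of `M`; in particular natural numbers, rationals and
reals are those of `M`. -/

/-- The formal fraction `(pos - neg) / den` (used with positive `den`). -/
structure Frac : Type u where
  pos : M.D .nat
  neg : M.D .nat
  den : M.D .nat

namespace Frac

variable {M}

instance : Zero M.Frac := ⟨⟨0, 0, 1⟩⟩
instance : One M.Frac := ⟨⟨1, 0, 1⟩⟩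
instance : Inhabited M.Frac := ⟨0⟩
instance : Add M.Frac :=
  ⟨fun r s => ⟨r.pos * s.den + s.pos * r.den, r.neg * s.den + s.neg * r.den, r.den * s.den⟩⟩
instance : Sub M.Frac :=
  ⟨fun r s => ⟨r.pos * s.den + s.neg * r.den, r.neg * s.den + s.pos * r.den, r.den * s.den⟩⟩

/-- `r < s` for fractions with positive denominators. -/
protected def Lt (r s : M.Frac) : Prop :=
  r.pos * s.den + s.neg * r.den < s.pos * r.den + r.neg * s.den

end Frac

/-- The number `c` is the code of the signed quotient `r`: `c` is the Cantor code of the pair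
`(k, m)` (that is, `2c = (k + m)(k + m + 1) + 2k`), where `r` has denominator `m + 1` and numerator
`k / 2` if `k` is even, and numerator `-(k + 1) / 2` if `k` is odd. -/
def Codes (c : M.D .nat) (r : M.Frac) : Prop :=
  ∃ k m : M.D .nat, c + c = (k + m) * (k + m + 1) + (k + k) ∧ r.den = m + 1 ∧
    ((k = r.pos + r.pos ∧ r.neg = 0) ∨ (k + 1 = r.neg + r.neg ∧ r.pos = 0))

/-- The rational number with code `c`.  (In a model of `RCA₀^ω` every number is the code of exactly
one signed quotient.) -/
noncomputable def decode (c : M.D .nat) : M.Frac := Classical.epsilon (M.Codes c)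

/-- The function `m ↦ m + m`, i.e. the closed term `Σ (+) (Σ Π Π)`. -/
def double : M.D .one :=
  M.app (M.app (M.const (.combSigma .nat .nat .nat)) (M.const .add))
    (M.app (M.app (M.const (.combSigma .nat .one .nat)) (M.const (.combPi .nat .one)))
      (M.const (.combPi .nat .nat)))

/-- `2 ^ n`, by primitive recursion. -/
def pow2 (n : M.D .nat) : M.D .nat :=
  M.app (M.app (M.app (M.const (.recursor .nat))
    (M.app (M.const (.combPi .one .nat)) M.double)) 1) n

/-- The rational `2 ^ (-n)`. -/
def eps (n : M.D .nat) : M.Frac := ⟨1, 0, M.pow2 n⟩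

/-! ## Real numbers

Reals are type `1` objects coding fast-converging Cauchy sequences of rationals.  Differences and
sums of reals and rationals are handled through the pointwise operations on the associated
sequences of rationals. -/

/-- The sequence of rationals coded by a type `1` object. -/
noncomputable def val (x : M.D .one) : M.D .nat → M.Frac := fun n => M.decode (M.app x n)

/-- The constant sequence of a rational. -/
def cst (r : M.Frac) : M.D .nat → M.Frac := fun _ => r

/-- `x ∈ ℝ`: `|q_n - q_{n+i}| < 2 ^ (-n)` for all `n, i`. -/
def IsReal (x : M.D .one) : Prop :=
  ∀ n i : M.D .nat, (M.val x n - M.val x (n + i)).Lt (M.eps n) ∧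
    (M.val x (n + i) - M.val x n).Lt (M.eps n)

/-- `x =_ℝ y`: `|q_n - r_n| ≤ 2 ^ (-n+1)` for all `n`. -/
def RealEq (x y : M.D .one) : Prop :=
  ∀ n : M.D .nat, ¬ (M.eps n + M.eps n).Lt (M.val x n - M.val y n) ∧
    ¬ (M.eps n + M.eps n).Lt (M.val y n - M.val x n)

/-- Strict inequality between the reals given by Cauchy sequences of rationals: from some index on,
the difference is bigger than some fixed `2 ^ (-l)`. -/
def RLt (X Y : M.D .nat → M.Frac) : Prop :=
  ∃ l K : M.D .nat, ∀ i : M.D .nat, (X (K + i) + M.eps l).Lt (Y (K + i))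

/-- Non-strict inequality. -/
def RLe (X Y : M.D .nat → M.Frac) : Prop := ¬ M.RLt Y X

/-- `|x - y| < 2 ^ (-k)`. -/
def Close (x y : M.D .one) (k : M.D .nat) : Prop :=
  M.RLt (M.val x - M.val y) (M.cst (M.eps k)) ∧ M.RLt (M.val y - M.val x) (M.cst (M.eps k))

/-- `x ∈ [0,1]`. -/
def InUnit (x : M.D .one) : Prop :=
  M.IsReal x ∧ M.RLe (M.cst 0) (M.val x) ∧ M.RLe (M.val x) (M.cst 1)

/-! ## Sets and functions -/

/-- `A` is (the characteristic function of) a subset of `[0,1]`. -/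
def IsSubset (A : M.D .two) : Prop :=
  (∀ x, M.InUnit x → M.app A x = 0 ∨ M.app A x = 1) ∧
    ∀ x y, M.InUnit x → M.InUnit y → M.RealEq x y → M.app A x = M.app A y

/-- `x ∈ A`, for a subset `A` of `[0,1]`. -/
def Mem (x : M.D .one) (A : M.D .two) : Prop := M.InUnit x ∧ M.app A x = 1

/-- `A` is open (in `[0,1]`). -/
def OpenSet (A : M.D .two) : Prop :=
  ∀ x, M.Mem x A → ∃ k : M.D .nat, ∀ y, M.InUnit y → M.Close x y k → M.Mem y A

/-- `A` is dense in `[0,1]`. -/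
def DenseSet (A : M.D .two) : Prop :=
  ∀ (k : M.D .nat) (b : M.D .one), M.InUnit b → ∃ a, M.Mem a A ∧ M.Close a b k

/-- `f` is (a representation of) a function `[0,1] → ℝ`. -/
def IsFun (f : M.D (.one ⟶ₜ .one)) : Prop :=
  (∀ x, M.InUnit x → M.IsReal (M.app f x)) ∧
    ∀ x y, M.InUnit x → M.InUnit y → M.RealEq x y → M.RealEq (M.app f x) (M.app f y)

/-- `f : [0,1] → ℝ` is continuous at `x`. -/
def ContAt (f : M.D (.one ⟶ₜ .one)) (x : M.D .one) : Prop :=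
  ∀ k : M.D .nat, ∃ N : M.D .nat, ∀ y, M.InUnit y → M.Close x y N →
    M.Close (M.app f x) (M.app f y) k

/-- `f : [0,1] → ℝ` has a point of continuity in `[0,1]`. -/
def HasContPoint (f : M.D (.one ⟶ₜ .one)) : Prop := ∃ x, M.InUnit x ∧ M.ContAt f x

/-- `f` is an upper semi-continuous function `[0,1] → ℝ`. -/
def Usco (f : M.D (.one ⟶ₜ .one)) : Prop :=
  M.IsFun f ∧ ∀ x, M.InUnit x → ∀ k : M.D .nat, ∃ N : M.D .nat, ∀ y, M.InUnit y → M.Close x y N →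
    M.RLt (M.val (M.app f y)) (M.val (M.app f x) + M.cst (M.eps k))

/-- The oscillation `sup f - inf f` of `f` on `B(x, 2 ^ (-k)) ∩ [0,1]` is bigger than `Y`.  (The
supremum and infimum need not exist in `M`; as usual the inequality is a shorthand.) -/
def OscGt (f : M.D (.one ⟶ₜ .one)) (x : M.D .one) (k : M.D .nat) (Y : M.D .nat → M.Frac) : Prop :=
  ∃ u v, M.InUnit u ∧ M.InUnit v ∧ M.Close x u k ∧ M.Close x v k ∧
    M.RLt Y (M.val (M.app f u) - M.val (M.app f v))

/-- `g : [0,1] → ℝ` is the oscillation function of `f : [0,1] → ℝ`: for all `x`, the oscillation of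
`f` on `B(x, 2 ^ (-k))` converges to `g(x)` for `k → ∞`. -/
def IsOscFun (f g : M.D (.one ⟶ₜ .one)) : Prop :=
  M.IsFun g ∧ ∀ x, M.InUnit x → ∀ l : M.D .nat, ∃ K : M.D .nat, ∀ i : M.D .nat,
    M.OscGt f x (K + i) (M.val (M.app g x) - M.cst (M.eps l)) ∧
      ¬ M.OscGt f x (K + i) (M.val (M.app g x) + M.cst (M.eps l))

/-- `f : [0,1] → ℝ` is countably continuous: `[0,1]` is the union of a sequence of sets on each of
which the restriction of `f` is continuous. -/
def CountablyCont (f : M.D (.one ⟶ₜ .one)) : Prop :=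
  ∃ E : M.D (.nat ⟶ₜ .two), (∀ n, M.IsSubset (M.app E n)) ∧
    (∀ x, M.InUnit x → ∃ n, M.Mem x (M.app E n)) ∧
    ∀ (m : M.D .nat) (x : M.D .one), M.Mem x (M.app E m) → ∀ k : M.D .nat, ∃ N : M.D .nat,
      ∀ y, M.Mem y (M.app E m) → M.Close x y N → M.Close (M.app f x) (M.app f y) k

/-! ## The principles, as statements about `M` -/

/-- The Baire category theorem for `[0,1]`. -/
def BCT : Prop :=
  ∀ O : M.D (.nat ⟶ₜ .two), (∀ n, M.IsSubset (M.app O n)) →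
    (∀ n x, M.Mem x (M.app O (n + 1)) → M.Mem x (M.app O n)) →
    (∀ n, M.OpenSet (M.app O n)) → (∀ n, M.DenseSet (M.app O n)) →
    ∃ x, ∀ n, M.Mem x (M.app O n)

/-- Every usco `f : [0,1] → ℝ` has a point of continuity. -/
def UscoContPoint : Prop := ∀ f, M.Usco f → M.HasContPoint f

/-- Every usco `f : [0,1] → ℝ` which has an oscillation function has a point of continuity. -/
def UscoOscContPoint : Prop := ∀ f, M.Usco f → (∃ g, M.IsOscFun f g) → M.HasContPoint f

/-- Every usco `f : [0,1] → ℝ` which is its own oscillation function has a point of continuity. -/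
def UscoOwnOscContPoint : Prop := ∀ f, M.Usco f → M.IsOscFun f f → M.HasContPoint f

/-- Every usco and countably continuous `f : [0,1] → ℝ` has a point of continuity. -/
def UscoCountablyContPoint : Prop := ∀ f, M.Usco f → M.CountablyCont f → M.HasContPoint f

/-- Every usco `f : [0,1] → ℝ` is bounded below by a rational `q` on some interval `(c, d)`. -/
def UscoBoundedBelow : Prop :=
  ∀ f, M.Usco f → ∃ (q : M.D .nat) (c d : M.D .one), M.InUnit c ∧ M.InUnit d ∧
    M.RLt (M.val c) (M.val d) ∧
    ∀ y, M.InUnit y → M.RLt (M.val c) (M.val y) → M.RLt (M.val y) (M.val d) →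
      M.RLe (M.cst (M.decode q)) (M.val (M.app f y))

/-- Every positive usco `f : [0,1] → ℝ` has positive infimum on some interval `[c, d]`, i.e. some
`2 ^ (-l)` is a lower bound of `f` on it. -/
def UscoPositiveInf : Prop :=
  ∀ f, M.Usco f → (∀ x, M.InUnit x → M.RLt (M.cst 0) (M.val (M.app f x))) →
    ∃ c d : M.D .one, M.InUnit c ∧ M.InUnit d ∧ M.RLt (M.val c) (M.val d) ∧
      ∃ l : M.D .nat, ∀ y, M.InUnit y → M.RLe (M.val c) (M.val y) → M.RLe (M.val y) (M.val d) →
        M.RLe (M.cst (M.eps l)) (M.val (M.app f y))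

end Structure

end HigherOrderArithmetic

namespace HigherOrderArithmetic.Structure

variable {M : Structure.{u}}

/-! ## Combinatory completeness -/

/-! From Baire to continuity points: for usco `f` let `O_n` consist of the `x` with `f(x) < -n`, or
such that `f(c) > f(x) - 2^(-n)`, with a uniform margin, for all rational `c` in some ball around
`x` (`ContApprox`). Quantifying over rationals only makes `O_n` arithmetical in `f`, so it exists in
the model; upper semi-continuity carries lower bounds from rational points to all points
(`Usco.le_of_rat`) and makes `O_n` open. For density, if `f ≥ -n` on a ball, the least number
principle finds a rational point there whose value is minimal among rationals up to `2^(-n-1)`. At a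
point of all `O_n` the alternative `f(x) < -n` fails for large `n`, and the other one is lower
semi-continuity.

Conversely, let dense open decreasing `O_n` have empty intersection. The level `h(x)`, the least `n`
with `x ∉ O_n`, exists by quantifier-free choice and `(∃²)` (`exists_isLevel`). Openness makes `h`
lower semi-continuous and density makes it unbounded on every ball. So `2^(-h)` is usco, positive,
constant on each level set, its own oscillation function, nowhere continuous, and without positive
lower bound on any interval, while `-h` is usco and unbounded below on every interval. This refutes
(d), (e), (f) and (g); the remaining implications are specialisations of (b) or local consequences
of continuity at a point.

The model may be nonstandard, so everything is internal. Two devices make this workable. Predicates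
with a characteristic term (`Arith`) are closed under number quantifiers by `(∃²)`, and for them
induction, least elements, choice and sets are available. For inequalities, the reals of the model
are mapped to an ordered ring `R`: bounded elements of an ultrapower of the model's rationals,
modulo infinitesimals. Order, equality and closeness of reals become order, equality and distance
there (`Conv.rlt_iff`, `realEq_iff`, `close_iff`). -/

theorem EqAt.trans : ∀ {τ : FType} {x y z : M.D τ}, M.EqAt τ x y → M.EqAt τ y z → M.EqAt τ x z
  | .nat, _, _, _, h, h' => Eq.trans h h'
  | .arrow _ _, _, _, _, h, h' => fun w => EqAt.trans (h w) (h' w)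

/-- The maps given by terms with parameters from the structure. -/
inductive IsTerm : {Γ : List FType} → {τ : FType} → (M.Env Γ → M.D τ) → Prop
  | const {Γ : List FType} {τ : FType} (c : M.D τ) : IsTerm (Γ := Γ) fun _ => c
  | var {Γ : List FType} {τ : FType} (v : Var Γ τ) : IsTerm fun e => M.varVal v e
  | app {Γ : List FType} {σ τ : FType} {F : M.Env Γ → M.D (σ ⟶ₜ τ)} {G : M.Env Γ → M.D σ} :
      IsTerm F → IsTerm G → IsTerm fun e => M.app (F e) (G e)

namespace IsTerm

variable {Γ : List FType} {σ τ σ₀ σ₁ σ₂ σ₃ σ₄ : FType}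

theorem weaken {F : M.Env Γ → M.D τ} (h : IsTerm F) :
    IsTerm (Γ := σ :: Γ) fun e => F e.2 := by
  induction h with
  | const c => exact .const c
  | var v => exact .var v.there
  | app _ _ h₁ h₂ => exact h₁.app h₂

/-- Weakening below a bound variable, which sits at the head of the context. -/
theorem weaken₁ {F : M.Env (σ₀ :: Γ) → M.D τ} (h : IsTerm F) :
    IsTerm (Γ := σ₀ :: σ :: Γ) fun e => F (e.1, e.2.2) := by
  -- The induction needs a variable context, so its shape is carried as an equation.
  suffices H : ∀ {Δ : List FType} {τ : FType} {F : M.Env Δ → M.D τ}, IsTerm F →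
      ∀ h : Δ = σ₀ :: Γ, IsTerm (Γ := σ₀ :: σ :: Γ) fun e => F (h ▸ ((e.1, e.2.2) :
        M.Env (σ₀ :: Γ))) from H h rfl
  intro Δ τ F hF
  induction hF with
  | const c => exact fun _ => .const c
  | app _ _ h₁ h₂ => exact fun h => (h₁ h).app (h₂ h)
  | var v =>
    rintro rfl
    cases v with
    | here => exact .var .here
    | there v => exact .var v.there.there

theorem var₀ : IsTerm (M := M) (Γ := σ₀ :: Γ) fun e => e.1 := .var .here
theorem var₁ : IsTerm (M := M) (Γ := σ₀ :: σ₁ :: Γ) fun e => e.2.1 := .var (.there .here)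
theorem var₂ : IsTerm (M := M) (Γ := σ₀ :: σ₁ :: σ₂ :: Γ) fun e => e.2.2.1 :=
  .var (.there (.there .here))
theorem var₃ : IsTerm (M := M) (Γ := σ₀ :: σ₁ :: σ₂ :: σ₃ :: Γ) fun e => e.2.2.2.1 :=
  .var (.there (.there (.there .here)))
theorem var₄ : IsTerm (M := M) (Γ := σ₀ :: σ₁ :: σ₂ :: σ₃ :: σ₄ :: Γ) fun e => e.2.2.2.2.1 :=
  .var (.there (.there (.there (.there .here))))

theorem app₂ {ρ : FType} (c : M.D (σ ⟶ₜ τ ⟶ₜ ρ)) {F : M.Env Γ → M.D σ} {G : M.Env Γ → M.D τ}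
    (hF : IsTerm F) (hG : IsTerm G) : IsTerm fun e => M.app (M.app c (F e)) (G e) :=
  ((IsTerm.const c).app hF).app hG

theorem add {F G : M.Env Γ → M.D .nat} (hF : IsTerm F) (hG : IsTerm G) :
    IsTerm fun e => F e + G e := app₂ _ hF hG

theorem mul {F G : M.Env Γ → M.D .nat} (hF : IsTerm F) (hG : IsTerm G) :
    IsTerm fun e => F e * G e := app₂ _ hF hG

theorem pow2 {F : M.Env Γ → M.D .nat} (hF : IsTerm F) : IsTerm fun e => M.pow2 (F e) :=
  (IsTerm.const _).app hF

/-- Combinatory completeness: abstraction of a variable. -/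
theorem exists_lam (hM : M.ModelsRCA0ω) {F : M.Env (σ :: Γ) → M.D τ} (h : IsTerm F) :
    ∃ G : M.Env Γ → M.D (σ ⟶ₜ τ), IsTerm G ∧
      ∀ e x, M.EqAt τ (M.app (G e) x) (F (x, e)) := by
  suffices H : ∀ {Δ : List FType} {τ : FType} {F : M.Env Δ → M.D τ}, IsTerm F →
      ∀ h : Δ = σ :: Γ, ∃ G : M.Env Γ → M.D (σ ⟶ₜ τ), IsTerm G ∧
      ∀ e x, M.EqAt τ (M.app (G e) x) (F (h ▸ ((x, e) : M.Env (σ :: Γ)))) from H h rfl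
  intro Δ τ F hF
  induction hF with
  | @const τ c =>
    exact fun _ => ⟨fun _ => M.app (M.const (.combPi τ σ)) c, .const _,
      fun _ x => hM.combPi_eq _ _ _ _⟩
  | var v =>
    rintro rfl
    cases v with
    | here =>
      -- The identity, as the combinator `Σ Π Π`.
      refine ⟨fun _ => M.app (M.app (M.const (.combSigma σ (σ ⟶ₜ σ) σ))
        (M.const (.combPi σ (σ ⟶ₜ σ)))) (M.const (.combPi σ σ)), .const _, fun _ x => ?_⟩
      exact (hM.combSigma_eq _ _ _ _ _ _).trans (hM.combPi_eq _ _ _ _)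
    | there v =>
      exact ⟨fun e => M.app (M.const (.combPi _ σ)) (M.varVal v e), (IsTerm.const _).app (.var v),
        fun _ x => hM.combPi_eq _ _ _ _⟩
  | @app ρ τ F₁ F₂ _ _ h₁ h₂ =>
    intro h
    obtain ⟨G₁, hG₁, e₁⟩ := h₁ h
    obtain ⟨G₂, hG₂, e₂⟩ := h₂ h
    refine ⟨fun e => M.app (M.app (M.const (.combSigma σ ρ τ)) (G₁ e)) (G₂ e),
      app₂ _ hG₁ hG₂, fun e x => ?_⟩
    -- The combinator axioms give equality only up to `EqAt`; replacing the argument of an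
    -- application therefore uses extensionality.
    exact (hM.combSigma_eq _ _ _ _ _ _).trans
      ((e₁ e x _).trans (hM.extensionality _ _ _ _ _ (e₂ e x)))

end IsTerm

/-! ## Arithmetical predicates -/

variable [hM : Fact M.ModelsACA0ω]

theorem rca : M.ModelsRCA0ω := hM.out.toModelsRCA0ω

theorem zero_ne_one : (0 : M.D .nat) ≠ 1 := fun h =>
  rca.semiring.lt_irrefl (1 : M.D .nat) (by simpa [h] using rca.semiring.zero_lt_one (M := M))

theorem nat_zero_add (a : M.D .nat) : 0 + a = a := by
  rw [rca.semiring.add_comm, rca.semiring.add_zero]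

theorem nat_zero_mul (a : M.D .nat) : 0 * a = 0 := by
  rw [rca.semiring.mul_comm, rca.semiring.mul_zero]

theorem nat_mul_zero (a : M.D .nat) : a * 0 = 0 := rca.semiring.mul_zero a

theorem combPi_combPi (b m n : M.D .nat) :
    M.app (M.app (M.app (M.const (.combPi (.nat ⟶ₜ .nat) .nat))
      (M.app (M.const (.combPi .nat .nat)) b)) n) m = b :=
  EqAt.trans (τ := .nat) ((rca (M := M)).combPi_eq .one .nat _ n m)
    ((rca (M := M)).combPi_eq .nat .nat b m)

/-- The predicates having a characteristic function given by a term with parameters. -/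
def Arith {Γ : List FType} (P : M.Env Γ → Prop) : Prop :=
  ∃ F : M.Env Γ → M.D .nat, IsTerm F ∧ ∀ e, (F e = 0 ∨ F e = 1) ∧ (P e ↔ F e = 1)

/-- Choice of numbers for quantifier-free matrices given by a characteristic term. -/
theorem exists_choice_of_isTerm {F : M.Env [.nat, .one] → M.D .nat} (hF : IsTerm F)
    (h : ∀ x : M.D .one, ∃ y : M.D .nat, F (y, x, PUnit.unit) = 1) :
    ∃ Y : M.D .two, ∀ x, F (M.app Y x, x, PUnit.unit) = 1 := by
  obtain ⟨G, hG, e₁⟩ := hF.exists_lam rca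
  obtain ⟨H, -, e₂⟩ := hG.exists_lam rca
  have key : ∀ x y, M.app (M.app (H PUnit.unit) x) y = F (y, x, PUnit.unit) := fun x y =>
    (e₂ PUnit.unit x y).trans (e₁ (x, PUnit.unit) y)
  -- All parameters are absorbed into the single object `H`, so that the matrix becomes the prime
  -- formula `z x y = 1`.
  obtain ⟨Y, hY⟩ := (rca (M := M)).qf_choice [FType.one ⟶ₜ FType.one]
    (.eq (.app (.app (.var (.there (.there .here))) (.var (.there .here))) (.var .here))
      (.const .one)) (H PUnit.unit, PUnit.unit) fun x => by
        obtain ⟨y, hy⟩ := h x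
        exact ⟨y, (key x y).trans hy⟩
  exact ⟨Y, fun x => (key x _).symm.trans (hY x)⟩

namespace Arith

variable {Γ : List FType} {P Q : M.Env Γ → Prop}

omit hM in
theorem congr (hP : Arith P) (h : ∀ e, Q e ↔ P e) : Arith Q := by
  rwa [show Q = P from funext fun e => propext (h e)]

/-- Recursion with start value `1` and constant step value `0` exchanges the truth values. -/
theorem not (h : Arith P) : Arith fun e => ¬ P e := by
  obtain ⟨F, hF, h⟩ := h
  let c : M.D (.nat ⟶ₜ .nat ⟶ₜ .nat) :=
    M.app (M.const (.combPi (.nat ⟶ₜ .nat) .nat)) (M.app (M.const (.combPi .nat .nat)) 0)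
  have h0 : M.app (M.app (M.app (M.const (.recursor .nat)) c) 1) 0 = 1 := rca.recursor_zero _ _
  have h1 : M.app (M.app (M.app (M.const (.recursor .nat)) c) 1) 1 = 0 := by
    have := (rca (M := M)).recursor_succ c 1 0
    rw [nat_zero_add] at this
    exact this.trans (combPi_combPi _ _ _)
  refine ⟨fun e => M.app (M.app (M.app (M.const (.recursor .nat)) c) 1) (F e),
    (IsTerm.const _).app hF, fun e => ?_⟩
  beta_reduce
  rw [(h e).2]
  rcases (h e).1 with he | he <;> simp [he, h0, h1, zero_ne_one]

theorem and (hP : Arith P) (hQ : Arith Q) : Arith fun e => P e ∧ Q e := by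
  obtain ⟨F, hF, h⟩ := hP
  obtain ⟨G, hG, h'⟩ := hQ
  refine ⟨fun e => F e * G e, hF.mul hG, fun e => ?_⟩
  beta_reduce
  rw [(h e).2, (h' e).2]
  rcases (h e).1 with he | he <;> rcases (h' e).1 with he' | he' <;>
    simp [he, he', zero_ne_one, rca.semiring.mul_one, nat_mul_zero]

theorem or (hP : Arith P) (hQ : Arith Q) : Arith fun e => P e ∨ Q e :=
  (hP.not.and hQ.not).not.congr fun _ => by tauto

theorem imp (hP : Arith P) (hQ : Arith Q) : Arith fun e => P e → Q e :=
  (hP.and hQ.not).not.congr fun _ => by tauto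

/-- The one use of `(∃²)`. Its functional detects zeros, so it is applied to the characteristic
function of the negated matrix. -/
theorem ex {R : M.D .nat → M.Env Γ → Prop}
    (h : Arith (Γ := .nat :: Γ) fun e => R e.1 e.2) : Arith fun e => ∃ n, R n e := by
  obtain ⟨F, hF, h⟩ := h.not
  obtain ⟨φ, hφ⟩ := hM.out.exists_two
  obtain ⟨G, hG, e₁⟩ := hF.exists_lam rca
  have : Arith fun e => ¬ ∃ n, R n e := by
    refine ⟨fun e => M.app φ (G e), (IsTerm.const _).app hG, fun e => ⟨(hφ _).1, ?_⟩⟩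
    have key : (∃ n, R n e) ↔ M.app φ (G e) = 0 := by
      rw [← (hφ _).2]
      refine exists_congr fun n => ?_
      have h1 : M.app (G e) n = F (n, e) := e₁ e n
      have h2 := h (n, e)
      rw [h1, ← not_iff_not]
      rcases h2.1 with h3 | h3 <;> simp [h2.2, h3, zero_ne_one, zero_ne_one.symm]
    beta_reduce
    rw [key]
    rcases (hφ (G e)).1 with h3 | h3 <;> simp [h3, zero_ne_one, zero_ne_one.symm]
  exact this.not.congr fun e => by tauto

theorem all {R : M.D .nat → M.Env Γ → Prop}
    (h : Arith (Γ := .nat :: Γ) fun e => R e.1 e.2) : Arith fun e => ∀ n, R n e :=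
  (ex (R := fun n e => ¬ R n e) h.not).not.congr fun e => by simp

/-- The relation `<` is primitive and has no term attached to it; a characteristic functional comes
from quantifier-free choice. Choice takes type `1` arguments, so a pair `a, b` is coded by a
function with value `a` at `0` and `b` at `1`. -/
theorem lt {F G : M.Env Γ → M.D .nat} (hF : IsTerm F) (hG : IsTerm G) :
    Arith fun e => F e < G e := by
  obtain ⟨Y, hY⟩ := (rca (M := M)).qf_choice []
    (.or (.and (.lt (.app (.var (.there .here)) (.const .zero))
        (.app (.var (.there .here)) (.const .one))) (.eq (.var .here) (.const .one)))
      (.and (.neg (.lt (.app (.var (.there .here)) (.const .zero))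
        (.app (.var (.there .here)) (.const .one)))) (.eq (.var .here) (.const .zero))))
    PUnit.unit fun x => by
      by_cases h : M.app x 0 < M.app x 1
      · exact ⟨1, Or.inl ⟨h, rfl⟩⟩
      · exact ⟨0, Or.inr ⟨h, rfl⟩⟩
  let p : M.D .nat → M.D .nat → M.D .one := fun a b =>
    M.app (M.app (M.const (.recursor .nat)) (M.app (M.const (.combPi (.nat ⟶ₜ .nat) .nat))
      (M.app (M.const (.combPi .nat .nat)) b))) a
  have h0 : ∀ a b, M.app (p a b) 0 = a := fun a b => rca.recursor_zero _ _
  have h1 : ∀ a b, M.app (p a b) 1 = b := fun a b => by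
    have := (rca (M := M)).recursor_succ (M.app (M.const (.combPi (.nat ⟶ₜ .nat) .nat))
      (M.app (M.const (.combPi .nat .nat)) b)) a 0
    rw [nat_zero_add] at this
    exact this.trans (combPi_combPi _ _ _)
  refine ⟨fun e => M.app Y (p (F e) (G e)), (IsTerm.const _).app
    (((IsTerm.const _).app ((IsTerm.const _).app ((IsTerm.const _).app hG))).app hF), fun e => ?_⟩
  have key := hY (p (F e) (G e))
  change (M.app (p (F e) (G e)) 0 < M.app (p (F e) (G e)) 1 ∧ M.app Y (p (F e) (G e)) = 1) ∨
    (¬ M.app (p (F e) (G e)) 0 < M.app (p (F e) (G e)) 1 ∧ M.app Y (p (F e) (G e)) = 0) at key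
  rw [h0, h1] at key
  rcases key with ⟨h, h'⟩ | ⟨h, h'⟩ <;> simp [h, h', zero_ne_one]

theorem eq {F G : M.Env Γ → M.D .nat} (hF : IsTerm F) (hG : IsTerm G) :
    Arith fun e => F e = G e :=
  ((lt hF hG).not.and (lt hG hF).not).congr fun e => by
    constructor
    · rintro h
      rw [h]
      exact ⟨rca.semiring.lt_irrefl _, rca.semiring.lt_irrefl _⟩
    · rintro ⟨h, h'⟩
      have := rca.semiring.lt_total (F e) (G e)
      tauto

theorem exists_choice {P : M.D .nat → M.D .one → Prop}
    (hP : Arith (Γ := [.nat, .one]) fun e => P e.1 e.2.1) (h : ∀ x, ∃ y, P y x) :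
    ∃ Y : M.D .two, ∀ x, P (M.app Y x) x := by
  obtain ⟨F, hF, hPF⟩ := hP
  obtain ⟨Y, hY⟩ := exists_choice_of_isTerm hF fun x => by
    obtain ⟨y, hy⟩ := h x
    exact ⟨y, (hPF (y, x, PUnit.unit)).2.1 hy⟩
  exact ⟨Y, fun x => (hPF _).2.2 (hY x)⟩

/-- Once number quantifiers are absorbed into characteristic terms, quantifier-free induction is
arithmetical induction with parameters. -/
theorem induction {P : M.D .nat → Prop} (hP : Arith (Γ := [.nat]) fun e => P e.1)
    (h0 : P 0) (hs : ∀ n, P n → P (n + 1)) (n : M.D .nat) : P n := by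
  obtain ⟨F, hF, h⟩ := hP
  obtain ⟨G, -, e₁⟩ := hF.exists_lam rca
  have key : ∀ n, P n ↔ M.app (G PUnit.unit) n = 1 := fun n => by
    rw [show M.app (G PUnit.unit) n = F (n, PUnit.unit) from e₁ PUnit.unit n]
    exact (h (n, PUnit.unit)).2
  have := (rca (M := M)).qf_induction [.one]
    (.eq (.app (.var (.there .here)) (.var .here)) (.const .one)) (G PUnit.unit, PUnit.unit)
    ((key 0).1 h0) (fun n hn => (key _).1 (hs n ((key n).2 hn))) n
  exact (key n).2 this

end Arith

end HigherOrderArithmetic.Structure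

namespace HigherOrderArithmetic

/-! ## The ordered ring of quotients of differences of an ordered semiring -/

section Quotients

/-- The formal fraction `(pos - neg) / den` with positive denominator. -/
structure PreQuot (N : Type u) [CommSemiring N] [LinearOrder N] where
  pos : N
  neg : N
  den : N
  den_pos : 0 < den

variable {N : Type u} [CommSemiring N] [LinearOrder N] [IsStrictOrderedRing N]
  [ExistsAddOfLE N]

/-- Equality of the numbers given by formal fractions. -/
instance PreQuot.setoid : Setoid (PreQuot N) where
  r x y := x.pos * y.den + y.neg * x.den = y.pos * x.den + x.neg * y.den
  iseqv :=
    { refl := fun x => rfl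
      symm := fun {x y} h => h.symm
      trans := fun {x y z} h h' => by
        refine mul_right_cancel₀ y.den_pos.ne' ?_
        linear_combination z.den * h + x.den * h' }

theorem PreQuot.equiv_iff {x y : PreQuot N} :
    x ≈ y ↔ x.pos * y.den + y.neg * x.den = y.pos * x.den + x.neg * y.den := Iff.rfl

variable (N) in
/-- The ordered ring of the quotients `(p - n) / d` with `d > 0`. -/
def FracDiff : Type u := Quotient (PreQuot.setoid (N := N))

namespace FracDiff

/-- The element `(p - n) / d`. -/
def mk (p n d : N) (h : 0 < d) : FracDiff N := Quotient.mk _ ⟨p, n, d, h⟩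

@[elab_as_elim]
theorem ind {C : FracDiff N → Prop} (h : ∀ p n d hd, C (mk p n d hd)) (x : FracDiff N) : C x :=
  Quotient.ind (fun ⟨p, n, d, hd⟩ => h p n d hd) x

theorem mk_eq_mk {p n d p' n' d' : N} {h h'} :
    mk p n d h = mk p' n' d' h' ↔ p * d' + n' * d = p' * d + n * d' :=
  Quotient.eq (r := PreQuot.setoid)

instance : Zero (FracDiff N) := ⟨mk 0 0 1 zero_lt_one⟩
instance : One (FracDiff N) := ⟨mk 1 0 1 zero_lt_one⟩
instance : Neg (FracDiff N) := ⟨Quotient.map (fun x => ⟨x.neg, x.pos, x.den, x.den_pos⟩) (by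
  rintro x y h
  rw [PreQuot.equiv_iff] at h ⊢
  linear_combination -h)⟩
instance : Add (FracDiff N) := ⟨Quotient.map₂ (fun x y => ⟨x.pos * y.den + y.pos * x.den,
  x.neg * y.den + y.neg * x.den, x.den * y.den, mul_pos x.den_pos y.den_pos⟩) (by
  rintro x x' h y y' h'
  rw [PreQuot.equiv_iff] at h h' ⊢
  linear_combination (y.den * y'.den) * h + (x.den * x'.den) * h')⟩
instance : Mul (FracDiff N) := ⟨Quotient.map₂ (fun x y => ⟨x.pos * y.pos + x.neg * y.neg,
  x.pos * y.neg + x.neg * y.pos, x.den * y.den, mul_pos x.den_pos y.den_pos⟩) (by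
  rintro x x' h y y' h'
  rw [PreQuot.equiv_iff] at h h' ⊢
  -- Subtraction is missing in `N`: the mixed products are added on both sides, which lets each
  -- hypothesis be used in both directions.
  refine add_right_cancel (b := x'.pos * y.neg * x.den * y'.den + x'.neg * y.pos * x.den * y'.den
    + x'.pos * y.pos * x.den * y'.den + x'.neg * y.neg * x.den * y'.den) ?_
  linear_combination (y.pos * y'.den) * h + (y.neg * y'.den) * h.symm +
    (x'.pos * x.den) * h' + (x'.neg * x.den) * h'.symm)⟩

theorem zero_def : (0 : FracDiff N) = mk 0 0 1 zero_lt_one := rfl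
theorem one_def : (1 : FracDiff N) = mk 1 0 1 zero_lt_one := rfl
theorem neg_mk {p n d : N} {h} : -mk p n d h = mk n p d h := rfl
theorem mk_add_mk {p n d p' n' d' : N} {h h'} : mk p n d h + mk p' n' d' h' =
    mk (p * d' + p' * d) (n * d' + n' * d) (d * d') (mul_pos h h') := rfl
theorem mk_mul_mk {p n d p' n' d' : N} {h h'} : mk p n d h * mk p' n' d' h' =
    mk (p * p' + n * n') (p * n' + n * p') (d * d') (mul_pos h h') := rfl

instance : CommRing (FracDiff N) where
  add_assoc x y z := by
    induction x using ind; induction y using ind; induction z using ind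
    simp only [mk_add_mk, mk_eq_mk]; ring
  zero_add x := by
    induction x using ind
    simp only [zero_def, mk_add_mk, mk_eq_mk]; ring
  add_zero x := by
    induction x using ind
    simp only [zero_def, mk_add_mk, mk_eq_mk]; ring
  add_comm x y := by
    induction x using ind; induction y using ind
    simp only [mk_add_mk, mk_eq_mk]; ring
  nsmul := nsmulRec
  zsmul := zsmulRec
  neg_add_cancel x := by
    induction x using ind
    simp only [zero_def, neg_mk, mk_add_mk, mk_eq_mk]; ring
  mul_assoc x y z := by
    induction x using ind; induction y using ind; induction z using ind
    simp only [mk_mul_mk, mk_eq_mk]; ring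
  mul_comm x y := by
    induction x using ind; induction y using ind
    simp only [mk_mul_mk, mk_eq_mk]; ring
  one_mul x := by
    induction x using ind
    simp only [one_def, mk_mul_mk, mk_eq_mk]; ring
  mul_one x := by
    induction x using ind
    simp only [one_def, mk_mul_mk, mk_eq_mk]; ring
  zero_mul x := by
    induction x using ind
    simp only [zero_def, mk_mul_mk, mk_eq_mk]; ring
  mul_zero x := by
    induction x using ind
    simp only [zero_def, mk_mul_mk, mk_eq_mk]; ring
  left_distrib x y z := by
    induction x using ind; induction y using ind; induction z using ind
    simp only [mk_mul_mk, mk_add_mk, mk_eq_mk]; ring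
  right_distrib x y z := by
    induction x using ind; induction y using ind; induction z using ind
    simp only [mk_mul_mk, mk_add_mk, mk_eq_mk]; ring

theorem mk_sub_mk {p n d p' n' d' : N} {h h'} : mk p n d h - mk p' n' d' h' =
    mk (p * d' + n' * d) (n * d' + p' * d) (d * d') (mul_pos h h') := by
  rw [sub_eq_add_neg, neg_mk, mk_add_mk]

/-- Nonnegativity of a quotient of a difference. -/
def Nonneg (x : FracDiff N) : Prop := ∃ p n d hd, n ≤ p ∧ x = mk p n d hd

/-- Nonnegativity does not depend on the representative: `p < n` here and `n' ≤ p'` there,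
multiplied by the denominators and added, contradict the equality of the fractions. -/
theorem nonneg_mk {p n d : N} {h : 0 < d} : Nonneg (mk p n d h) ↔ n ≤ p := by
  refine ⟨?_, fun h' => ⟨p, n, d, h, h', rfl⟩⟩
  rintro ⟨p', n', d', h', hle, e⟩
  rw [mk_eq_mk] at e
  by_contra! hlt
  have h1 := mul_lt_mul_of_pos_right hlt h'
  have h2 := mul_le_mul_of_nonneg_right hle h.le
  have h3 := add_lt_add_of_lt_of_le h1 h2
  exact h3.ne (by linear_combination e)

variable (N) in
/-- The nonnegative elements. -/
def cone : RingCone (FracDiff N) where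
  carrier := {x | Nonneg x}
  zero_mem' := nonneg_mk.2 le_rfl
  one_mem' := nonneg_mk.2 zero_le_one
  add_mem' {x y} hx hy := by
    induction x using ind; induction y using ind
    replace hx := nonneg_mk.1 hx
    replace hy := nonneg_mk.1 hy
    refine nonneg_mk.2 ?_
    gcongr
  mul_mem' {x y} hx hy := by
    induction x using ind with | _ p n d hd
    induction y using ind with | _ p' n' d' hd'
    exact nonneg_mk.2 (mul_add_mul_le_mul_add_mul' (nonneg_mk.1 hx) (nonneg_mk.1 hy))
  eq_zero_of_mem_of_neg_mem' {x} hx hy := by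
    induction x using ind with | _ p n d hd
    rw [neg_mk] at hy
    have h1 := nonneg_mk.1 hx
    have h2 := nonneg_mk.1 hy
    rw [zero_def, mk_eq_mk, le_antisymm h1 h2]
    ring

instance : HasMemOrNegMem (cone N) where
  mem_or_neg_mem x := by
    induction x using ind with | _ p n d hd
    exact (le_total n p).imp nonneg_mk.2 nonneg_mk.2

open Classical in
noncomputable instance : LinearOrder (FracDiff N) := .mkOfAddGroupCone (cone N)

instance : IsOrderedRing (FracDiff N) := .mkOfCone (cone N)

theorem mk_le_mk {p n d p' n' d' : N} {h h'} :
    mk p n d h ≤ mk p' n' d' h' ↔ p * d' + n' * d ≤ p' * d + n * d' := by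
  change Nonneg _ ↔ _
  rw [mk_sub_mk, nonneg_mk, add_comm (n' * d)]

theorem mk_lt_mk {p n d p' n' d' : N} {h h'} :
    mk p n d h < mk p' n' d' h' ↔ p * d' + n' * d < p' * d + n * d' := by
  rw [← not_le, mk_le_mk, not_le]

instance : IsStrictOrderedRing (FracDiff N) :=
  haveI : Nontrivial (FracDiff N) := ⟨0, 1, fun h => by
    rw [zero_def, one_def, mk_eq_mk] at h
    simp at h⟩
  .of_mul_pos fun x y => by
    induction x using ind with | _ p n d hd
    induction y using ind with | _ p' n' d' hd'
    simp only [zero_def, mk_mul_mk, mk_lt_mk]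
    intro h h'
    have h1 : n < p := by simpa using h
    have h2 : n' < p' := by simpa using h'
    have := mul_add_mul_lt_mul_add_mul' h1 h2
    simpa [add_comm] using this

end FracDiff

end Quotients

end HigherOrderArithmetic

namespace HigherOrderArithmetic

namespace FracDiff

variable {N : Type u} [CommSemiring N] [LinearOrder N] [IsStrictOrderedRing N] [ExistsAddOfLE N]

/-- A nonzero difference is `±c` with `c > 0` in `N`, because differences exist in `N` in the
direction of the order. So `±c / d` has the inverse `±d / c`. -/
theorem isField : IsField (FracDiff N) where
  exists_pair_ne := exists_pair_ne _
  mul_comm := mul_comm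
  mul_inv_cancel {x} hx := by
    induction x using ind with | _ p n d hd
    rcases lt_trichotomy n p with h | h | h
    · obtain ⟨c, hc, rfl⟩ := exists_pos_add_of_lt' h
      refine ⟨mk d 0 c hc, ?_⟩
      rw [mk_mul_mk, one_def, mk_eq_mk]
      ring
    · refine absurd ?_ hx
      rw [zero_def, mk_eq_mk, h]
      ring
    · obtain ⟨c, hc, rfl⟩ := exists_pos_add_of_lt' h
      refine ⟨mk 0 d c hc, ?_⟩
      rw [mk_mul_mk, one_def, mk_eq_mk]
      ring

noncomputable instance : Field (FracDiff N) := isField.toField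

end FracDiff

/-! ## The standard part relative to an ordered subfield -/

section StandardPart

variable {K F : Type*} [Field K] [LinearOrder K] [IsStrictOrderedRing K]
  [Field F] [LinearOrder F] [IsStrictOrderedRing F] (c : K →+*o F)

omit [IsStrictOrderedRing K] [IsStrictOrderedRing F] in
theorem map_pos_of_pos {c : K →+*o F} {x : K} (hx : 0 < x) : 0 < c x := by
  have h : c 0 ≤ c x := c.monotone' hx.le
  rw [map_zero] at h
  refine lt_of_le_of_ne h fun h' => hx.ne' ?_
  exact (map_eq_zero (c : K →+* F)).1 h'.symm

/-- The elements of `F` bounded by elements of `K`. -/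
def finiteElements : Subring F where
  carrier := {x | ∃ k, |x| ≤ c k}
  zero_mem' := ⟨0, by simp⟩
  one_mem' := ⟨1, by simp⟩
  add_mem' := by
    rintro x y ⟨k, hk⟩ ⟨l, hl⟩
    exact ⟨k + l, by rw [map_add]; exact (abs_add_le _ _).trans (add_le_add hk hl)⟩
  neg_mem' := by
    rintro x ⟨k, hk⟩
    exact ⟨k, by rwa [abs_neg]⟩
  mul_mem' := by
    rintro x y ⟨k, hk⟩ ⟨l, hl⟩
    refine ⟨k * l, ?_⟩
    rw [map_mul, abs_mul]
    exact mul_le_mul hk hl (abs_nonneg _) ((abs_nonneg _).trans hk)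

/-- The bounded elements of `F` which are smaller than all positive elements of `K`. -/
def infinitesimals : Ideal (finiteElements c) where
  carrier := {x | ∀ ε, 0 < ε → |(x : F)| ≤ c ε}
  zero_mem' ε hε := by simpa using (map_pos_of_pos (c := c) hε).le
  add_mem' := by
    intro x y hx hy ε hε
    have := (abs_add_le (x : F) y).trans (add_le_add (hx _ (half_pos hε)) (hy _ (half_pos hε)))
    rwa [← map_add, add_halves] at this
  smul_mem' := by
    rintro ⟨x, k, hk⟩ y hy ε hε
    have hk' : (0 : K) < max k 1 := lt_max_of_lt_right one_pos
    have h := mul_le_mul (hk.trans (c.monotone' (le_max_left k 1))) (hy _ (div_pos hε hk'))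
      (abs_nonneg _) (map_pos_of_pos hk').le
    change _ ≤ c (max k 1) * _ at h
    rw [← map_mul, mul_div_cancel₀ _ hk'.ne', ← abs_mul] at h
    exact h

/-- The ordered ring of the bounded elements of `F` modulo infinitesimals. -/
def StdPart : Type _ := finiteElements c ⧸ infinitesimals c

namespace StdPart

noncomputable instance : CommRing (StdPart c) :=
  inferInstanceAs (CommRing (finiteElements c ⧸ infinitesimals c))

/-- The class of a bounded element. -/
def mk : finiteElements c →+* StdPart c := Ideal.Quotient.mk (infinitesimals c)

variable {c}

theorem mk_surjective : Function.Surjective (mk c) := Ideal.Quotient.mk_surjective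

theorem mk_eq_zero {x : finiteElements c} : mk c x = 0 ↔ ∀ ε, 0 < ε → |(x : F)| ≤ c ε :=
  Ideal.Quotient.eq_zero_iff_mem

variable (c) in
/-- The classes of nonnegative elements. -/
def cone : RingCone (StdPart c) where
  carrier := {r | ∃ x : finiteElements c, 0 ≤ x ∧ mk c x = r}
  zero_mem' := ⟨0, le_rfl, map_zero _⟩
  one_mem' := ⟨1, zero_le_one, map_one _⟩
  add_mem' := by
    rintro _ _ ⟨x, hx, rfl⟩ ⟨y, hy, rfl⟩
    exact ⟨x + y, add_nonneg hx hy, map_add _ _ _⟩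
  mul_mem' := by
    rintro _ _ ⟨x, hx, rfl⟩ ⟨y, hy, rfl⟩
    exact ⟨x * y, mul_nonneg hx hy, map_mul _ _ _⟩
  eq_zero_of_mem_of_neg_mem' := by
    rintro _ ⟨x, hx, rfl⟩ ⟨y, hy, h⟩
    rw [mk_eq_zero]
    intro ε hε
    have : mk c (x + y) = 0 := by rw [map_add, h, add_neg_cancel]
    refine le_trans ?_ (mk_eq_zero.1 this ε hε)
    have hx' : (0 : F) ≤ x := hx
    have hy' : (0 : F) ≤ y := hy
    rw [abs_of_nonneg hx', Subring.coe_add, abs_of_nonneg (add_nonneg hx' hy')]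
    exact le_add_of_nonneg_right hy'

instance : HasMemOrNegMem (cone c) where
  mem_or_neg_mem r := by
    obtain ⟨x, rfl⟩ := mk_surjective r
    exact (le_total 0 x).imp (fun h => ⟨x, h, rfl⟩)
      (fun h => ⟨-x, neg_nonneg.2 h, map_neg _ _⟩)

open Classical in
noncomputable instance : LinearOrder (StdPart c) := .mkOfAddGroupCone (cone c)

instance : IsOrderedRing (StdPart c) := .mkOfCone (cone c)

/-- A negative `x` has a nonnegative class only when it is infinitesimal, and then `0` represents
the class. -/
theorem mk_nonneg {x : finiteElements c} : 0 ≤ mk c x ↔ ∀ ε, 0 < ε → -(x : F) ≤ c ε := by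
  have h0 : 0 ≤ mk c x ↔ ∃ y : finiteElements c, 0 ≤ y ∧ mk c y = mk c x - 0 := Iff.rfl
  rw [h0]
  constructor
  · rintro ⟨y, hy, h⟩ ε hε
    have : mk c (x - y) = 0 := by rw [map_sub, h]; simp
    have h1 := neg_le_of_abs_le (mk_eq_zero.1 this ε hε)
    have hy' : (0 : F) ≤ y := hy
    rw [AddSubgroupClass.coe_sub] at h1
    linarith
  · intro h
    rcases le_total 0 x with hx | hx
    · exact ⟨x, hx, by simp⟩
    · refine ⟨0, le_rfl, ?_⟩
      rw [map_zero, sub_zero, eq_comm, mk_eq_zero]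
      intro ε hε
      rw [abs_of_nonpos (show (x : F) ≤ 0 from hx)]
      exact h ε hε

theorem mk_pos {x : finiteElements c} : 0 < mk c x ↔ ∃ ε, 0 < ε ∧ c ε < x := by
  rw [← not_le, ← neg_nonneg, ← map_neg, mk_nonneg]
  simp

/-- Strict inequality of classes means separation by a positive element of `K`, the shape in which
`RLt` is defined. -/
theorem mk_lt_mk {x y : finiteElements c} :
    mk c x < mk c y ↔ ∃ ε, 0 < ε ∧ (x : F) + c ε < y := by
  rw [← sub_pos, ← map_sub, mk_pos]
  simp [lt_sub_iff_add_lt']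

instance : IsStrictOrderedRing (StdPart c) :=
  haveI : Nontrivial (StdPart c) := ⟨0, 1, fun h => by
    have := mk_eq_zero.1 ((map_one (mk c)).trans h.symm) (1 / 2) (by norm_num)
    have h2 : c (1 / 2) < c 1 := by
      rw [← sub_pos, ← map_sub]
      exact map_pos_of_pos (by norm_num)
    rw [map_one] at h2
    simp only [Subring.coe_one, abs_one] at this
    linarith⟩
  .of_mul_pos fun r s => by
    obtain ⟨x, rfl⟩ := mk_surjective r
    obtain ⟨y, rfl⟩ := mk_surjective s
    rw [← map_mul, mk_pos, mk_pos, mk_pos]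
    rintro ⟨ε, hε, h⟩ ⟨δ, hδ, h'⟩
    refine ⟨ε * δ, mul_pos hε hδ, ?_⟩
    rw [map_mul]
    exact mul_lt_mul'' h h' (map_pos_of_pos hε).le (map_pos_of_pos hδ).le

end StdPart

end StandardPart

end HigherOrderArithmetic

namespace HigherOrderArithmetic.Structure

variable {M : Structure.{u}} [hM : Fact M.ModelsACA0ω]

/-! ## The numbers of a model -/

instance : CommSemiring (M.D .nat) where
  add_assoc := rca.semiring.add_assoc
  zero_add := nat_zero_add
  add_zero := rca.semiring.add_zero
  add_comm := rca.semiring.add_comm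
  nsmul := nsmulRec
  mul_assoc := rca.semiring.mul_assoc
  mul_comm := rca.semiring.mul_comm
  one_mul a := by rw [rca.semiring.mul_comm, rca.semiring.mul_one]
  mul_one := rca.semiring.mul_one
  zero_mul := nat_zero_mul
  mul_zero := rca.semiring.mul_zero
  left_distrib := rca.semiring.mul_add
  right_distrib a b c := by
    rw [rca.semiring.mul_comm, rca.semiring.mul_add, rca.semiring.mul_comm c,
      rca.semiring.mul_comm c]

open Classical in
noncomputable instance : LinearOrder (M.D .nat) where
  le a b := a < b ∨ a = b
  le_refl _ := .inr rfl
  le_trans a b c := by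
    rintro (h | rfl) (h' | rfl)
    · exact .inl (rca.semiring.lt_trans _ _ _ h h')
    · exact .inl h
    · exact .inl h'
    · exact .inr rfl
  lt_iff_le_not_ge a b := by
    have h1 := (rca (M := M)).semiring.lt_irrefl
    have h2 := (rca (M := M)).semiring.lt_trans
    constructor
    · refine fun h => ⟨.inl h, ?_⟩
      rintro (h' | rfl)
      · exact h1 _ (h2 _ _ _ h h')
      · exact h1 _ h
    · rintro ⟨h | rfl, h'⟩
      · exact h
      · exact absurd (.inr rfl) h'
  le_antisymm a b := by
    rintro (h | rfl) (h' | h'')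
    · exact absurd (rca.semiring.lt_trans _ _ _ h h') (rca.semiring.lt_irrefl _)
    · exact h''.symm
    · rfl
    · rfl
  le_total a b := by
    rcases rca.semiring.lt_total a b with h | h | h
    · exact .inl (.inl h)
    · exact .inl (.inr h)
    · exact .inr (.inl h)
  toDecidableLE := Classical.decRel _

instance : IsStrictOrderedRing (M.D .nat) where
  add_le_add_left a b h c := by
    rcases h with h | rfl
    · exact .inl (rca.semiring.add_lt_add _ _ _ h)
    · exact .inr rfl
  le_of_add_le_add_left a b c h := by
    by_contra! hlt
    have := (rca (M := M)).semiring.add_lt_add _ _ a hlt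
    rw [rca.semiring.add_comm c, rca.semiring.add_comm b] at this
    exact absurd h (not_le.2 this)
  zero_le_one := .inl rca.semiring.zero_lt_one
  exists_pair_ne := ⟨0, 1, zero_ne_one⟩
  mul_lt_mul_of_pos_left a ha b c h := by
    have := (rca (M := M)).semiring.mul_lt_mul _ _ a h ha
    rwa [rca.semiring.mul_comm b, rca.semiring.mul_comm c] at this
  mul_lt_mul_of_pos_right a ha b c h := rca.semiring.mul_lt_mul _ _ a h ha

section Arith

variable {Γ : List FType} {F G : M.Env Γ → M.D .nat}

theorem Arith.le (hF : IsTerm F) (hG : IsTerm G) : Arith fun e => F e ≤ G e :=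
  (Arith.lt hG hF).not.congr fun _ => not_lt.symm

end Arith

/-- The semiring axioms do not say that `0` is least; this and the discreteness of the order come
from induction. -/
theorem nat_nonneg (a : M.D .nat) : 0 ≤ a :=
  Arith.induction (P := fun a => 0 ≤ a) (.le (.const 0) .var₀) le_rfl
    (fun _ hn => hn.trans (le_add_of_nonneg_right zero_le_one)) a

theorem eq_zero_or_eq_add_one (a : M.D .nat) : a = 0 ∨ ∃ b, a = b + 1 :=
  Arith.induction (P := fun a => a = 0 ∨ ∃ b, a = b + 1)
    (by
      exact (Arith.eq .var₀ (.const 0)).or (Arith.ex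
        (.eq .var₁ (.add .var₀ (.const 1))))) (.inl rfl) (fun _ _ => .inr ⟨_, rfl⟩) a

/-- Existence of differences, needed for the canonical order and for the field of fractions. -/
theorem exists_add_one_add {b : M.D .nat} (a : M.D .nat) : a < b → ∃ c, b = a + (c + 1) :=
  Arith.induction (P := fun a => a < b → ∃ c, b = a + (c + 1))
    (by
      exact (Arith.lt .var₀ (.const b)).imp (Arith.ex
        (.eq (.const b) (.add .var₁ (.add .var₀ (.const 1))))))
    (fun h => by
      rcases eq_zero_or_eq_add_one b with rfl | ⟨c, rfl⟩
      · exact absurd h (lt_irrefl _)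
      · exact ⟨c, (zero_add _).symm⟩)
    (fun n ih h => by
      obtain ⟨c, rfl⟩ := ih ((lt_add_one n).trans h)
      rcases eq_zero_or_eq_add_one c with rfl | ⟨c, rfl⟩
      · rw [zero_add] at h
        exact absurd h (lt_irrefl _)
      · exact ⟨c, by ring⟩) a

instance : CanonicallyOrderedAdd (M.D .nat) where
  exists_add_of_le {a b} h := by
    rcases h.lt_or_eq with h | rfl
    · obtain ⟨c, hc⟩ := exists_add_one_add _ h
      exact ⟨_, hc⟩
    · exact ⟨0, (add_zero _).symm⟩
  le_add_self a b := le_add_of_nonneg_left (nat_nonneg _)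
  le_self_add a b := le_add_of_nonneg_right (nat_nonneg _)

theorem add_one_le_iff {a b : M.D .nat} : a + 1 ≤ b ↔ a < b := by
  refine ⟨fun h => (lt_add_one a).trans_le h, fun h => ?_⟩
  obtain ⟨c, rfl⟩ := exists_add_one_add _ h
  rw [add_comm c, ← add_assoc]
  exact le_self_add

theorem lt_add_one_iff {a b : M.D .nat} : a < b + 1 ↔ a ≤ b := by
  rw [← not_le, add_one_le_iff, not_lt]

/-- The least number principle. -/
theorem Arith.exists_least {P : M.D .nat → Prop} (hP : Arith (Γ := [.nat]) fun e => P e.1)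
    (h : ∃ n, P n) : ∃ n, P n ∧ ∀ m < n, ¬ P m := by
  by_contra! H
  -- Course-of-values induction, whose bounded quantifier is again arithmetical.
  have key : ∀ n, ∀ m < n, ¬ P m := fun n => by
    refine Arith.induction (P := fun n => ∀ m < n, ¬ P m) ?_ ?_ ?_ n
    · refine Arith.all ((Arith.lt .var₀ .var₁).imp ?_)
      obtain ⟨F, hF, h⟩ := hP
      exact Arith.not ⟨_, hF.weaken₁, fun e => h (e.1, e.2.2)⟩
    · exact fun m hm => absurd hm (not_lt.2 (nat_nonneg m))
    · intro n ih m hm hPm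
      rcases (lt_add_one_iff.1 hm).lt_or_eq with h' | rfl
      · exact ih m h' hPm
      · obtain ⟨k, hk, hPk⟩ := H m hPm
        exact ih k hk hPk
  obtain ⟨n, hn⟩ := h
  exact key (n + 1) n (lt_add_one n) hn

/-! ### Powers of two in the model. -/

theorem pow2_zero : M.pow2 0 = 1 := rca.recursor_zero _ _

theorem app_double (a : M.D .nat) : M.app M.double a = a + a := by
  have h1 := rca.combSigma_eq .nat .nat .nat (M.const .add)
    (M.app (M.app (M.const (.combSigma .nat .one .nat)) (M.const (.combPi .nat .one)))
      (M.const (.combPi .nat .nat))) a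
  have h2 : M.EqAt .nat _ _ := (rca (M := M)).combSigma_eq .nat .one .nat
    (M.const (.combPi .nat .one)) (M.const (.combPi .nat .nat)) a
  have h3 : M.EqAt .nat _ _ := (rca (M := M)).combPi_eq .nat .one a
    (M.app (M.const (.combPi .nat .nat)) a)
  have h4 := h2.trans h3
  exact Eq.trans h1 (congrArg (M.app _) h4)

theorem pow2_succ (n : M.D .nat) : M.pow2 (n + 1) = M.pow2 n + M.pow2 n := by
  have h := (rca (M := M)).recursor_succ (M.app (M.const (.combPi .one .nat)) M.double) 1 n
  have h' := (rca (M := M)).combPi_eq .one .nat M.double n (M.pow2 n)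
  exact h.trans (h'.trans (app_double _))

theorem pow2_pos (n : M.D .nat) : 0 < M.pow2 n :=
  Arith.induction (P := fun n => 0 < M.pow2 n) (.lt (.const 0) (.pow2 .var₀))
    (by rw [pow2_zero]; exact one_pos)
    (fun n hn => by rw [pow2_succ]; exact add_pos hn hn) n

/-- The reason why the `2 ^ (-n)` become smaller than every positive rational of the model. -/
theorem lt_pow2 (n : M.D .nat) : n < M.pow2 n :=
  Arith.induction (P := fun n => n < M.pow2 n) (.lt .var₀ (.pow2 .var₀))
    (pow2_pos 0)
    (fun n hn => by
      rw [pow2_succ]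
      exact add_lt_add_of_lt_of_le hn (add_one_le_iff.2 (pow2_pos n) |>.trans' (by simp))) n

theorem pow2_le_pow2_add (n i : M.D .nat) : M.pow2 n ≤ M.pow2 (n + i) :=
  Arith.induction (P := fun i => M.pow2 n ≤ M.pow2 (n + i))
    (.le (.const _) (.pow2 (.add (.const n) .var₀)))
    (by rw [add_zero])
    (fun i hi => by
      rw [← add_assoc, pow2_succ]
      exact hi.trans le_self_add) i

/-! ## Codes of rationals -/

theorem even_or_odd (k : M.D .nat) : ∃ p, k = p + p ∨ k + 1 = p + p :=
  Arith.induction (P := fun k => ∃ p, k = p + p ∨ k + 1 = p + p)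
    (by
      exact Arith.ex
        ((Arith.eq .var₁ (.add .var₀ .var₀)).or (.eq (.add .var₁ (.const 1)) (.add .var₀ .var₀))))
    ⟨0, .inl (zero_add _).symm⟩
    (fun k ⟨p, h⟩ => by
      rcases h with rfl | h
      · exact ⟨p + 1, .inr (by ring)⟩
      · exact ⟨p, .inl h⟩) k

theorem add_self_add_one_ne (p q : M.D .nat) : p + p + 1 ≠ q + q := by
  intro h
  rcases le_or_gt q p with h' | h'
  · exact absurd h (add_le_add h' h' |>.trans_lt (lt_add_one _)).ne'
  · have h1 := add_one_le_iff.2 h'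
    have h2 := add_lt_add_of_le_of_lt h1 h'
    rw [← h] at h2
    exact h2.ne (by ring)

theorem add_self_inj {p q : M.D .nat} (h : p + p = q + q) : p = q := by
  rcases lt_trichotomy p q with h' | h' | h'
  · exact absurd h (add_lt_add h' h').ne
  · exact h'
  · exact absurd h (add_lt_add h' h').ne'

/-- Walk along the antidiagonals: the next code after `(k, m + 1)` is that of `(k + 1, m)`, and
after `(k, 0)` comes `(0, k + 1)`. -/
theorem exists_pair (c : M.D .nat) :
    ∃ k m : M.D .nat, c + c = (k + m) * (k + m + 1) + (k + k) :=
  Arith.induction (P := fun c => ∃ k m : M.D .nat, c + c = (k + m) * (k + m + 1) + (k + k))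
    (by
      exact Arith.ex (Arith.ex (.eq (.add .var₂ .var₂) (.add (.mul (.add .var₁ .var₀)
        (.add (.add .var₁ .var₀) (.const 1))) (.add .var₁ .var₁)))))
    ⟨0, 0, by ring⟩
    (fun c ⟨k, m, h⟩ => by
      rcases eq_zero_or_eq_add_one m with rfl | ⟨m, rfl⟩
      · exact ⟨0, k + 1, by linear_combination h⟩
      · exact ⟨k + 1, m, by linear_combination h⟩) c

theorem exists_code (k m : M.D .nat) : ∃ c, c + c = (k + m) * (k + m + 1) + (k + k) := by
  have h : ∀ s : M.D .nat, ∃ c, c + c = s * (s + 1) := fun s =>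
    Arith.induction (P := fun s : M.D .nat => ∃ c, c + c = s * (s + 1))
      (by
        exact Arith.ex
          (.eq (.add .var₀ .var₀) (.mul .var₁ (.add .var₁ (.const 1)))))
      ⟨0, by ring⟩
      (fun s ⟨c, hc⟩ => ⟨c + (s + 1), by linear_combination hc⟩) s
  obtain ⟨c, hc⟩ := h (k + m)
  exact ⟨c + k, by linear_combination hc⟩

/-- Codes on a later antidiagonal are larger, so equal codes have equal sums `k + m`, and then equal
`k`. -/
theorem pair_inj {k m k' m' : M.D .nat} (h : (k + m) * (k + m + 1) + (k + k) =
    (k' + m') * (k' + m' + 1) + (k' + k')) : k = k' ∧ m = m' := by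
  have key : ∀ {k m k' m' : M.D .nat}, (k + m) * (k + m + 1) + (k + k) =
      (k' + m') * (k' + m' + 1) + (k' + k') → ¬ k + m < k' + m' := by
    intro k m k' m' h hlt
    obtain ⟨d, hd⟩ := exists_add_one_add _ hlt
    rw [hd] at h
    have h1 : (k + m) * (k + m + 1) + (k + k) + (m + m + (1 + 1)) ≤
        (k + m + (d + 1)) * (k + m + (d + 1) + 1) + (k' + k') := by
      refine le_iff_exists_add.2 ⟨(k + m) * d + (k + m) * d + d * d + d + d + d + (k' + k'), ?_⟩
      ring
    rw [h] at h1
    have h2 : (0 : M.D .nat) < m + m + (1 + 1) := add_pos_of_nonneg_of_pos (nat_nonneg _)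
      (add_pos one_pos one_pos)
    exact absurd h1 (not_le.2 (lt_add_of_pos_right _ h2))
  have hs : k + m = k' + m' := le_antisymm (not_lt.1 (key h.symm)) (not_lt.1 (key h))
  rw [hs] at h
  have hk := add_self_inj (add_left_cancel h)
  rw [hk] at hs
  exact ⟨hk, add_left_cancel hs⟩

theorem exists_codes (c : M.D .nat) : ∃ r, M.Codes c r := by
  obtain ⟨k, m, h⟩ := exists_pair c
  obtain ⟨p, hp | hp⟩ := even_or_odd k
  · exact ⟨⟨p, 0, m + 1⟩, k, m, h, rfl, .inl ⟨hp, rfl⟩⟩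
  · exact ⟨⟨0, p, m + 1⟩, k, m, h, rfl, .inr ⟨hp, rfl⟩⟩

theorem codes_decode (c : M.D .nat) : M.Codes c (M.decode c) :=
  Classical.epsilon_spec (exists_codes c)

theorem Codes.unique {c : M.D .nat} {r s : M.Frac} (hr : M.Codes c r) (hs : M.Codes c s) :
    r = s := by
  obtain ⟨k, m, h, hd, hn⟩ := hr
  obtain ⟨k', m', h', hd', hn'⟩ := hs
  obtain ⟨rfl, rfl⟩ := pair_inj (h.symm.trans h')
  obtain ⟨p, n, d⟩ := r
  obtain ⟨p', n', d'⟩ := s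
  simp only at hd hd' hn hn'
  subst hd hd'
  rcases hn with ⟨h1, rfl⟩ | ⟨h1, rfl⟩ <;> rcases hn' with ⟨h2, rfl⟩ | ⟨h2, rfl⟩
  · rw [add_self_inj (h1.symm.trans h2)]
  · rw [h1] at h2
    exact absurd h2 (add_self_add_one_ne _ _)
  · rw [h2] at h1
    exact absurd h1 (add_self_add_one_ne _ _)
  · rw [add_self_inj (h1.symm.trans h2)]

theorem decode_eq {c : M.D .nat} {r : M.Frac} (h : M.Codes c r) : M.decode c = r :=
  (codes_decode c).unique h

theorem decode_den_pos (c : M.D .nat) : 0 < (M.decode c).den := by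
  obtain ⟨k, m, -, h, -⟩ := codes_decode c
  rw [h]
  exact add_pos_of_nonneg_of_pos (nat_nonneg _) one_pos

/-- Every fraction equals one with a code. -/
theorem exists_decode_eq (p n d : M.D .nat) (hd : 0 < d) : ∃ c,
    (M.decode c).den = d ∧ (M.decode c).pos + n = p + (M.decode c).neg := by
  obtain ⟨m, hm⟩ := exists_add_one_add _ hd
  rw [zero_add] at hm
  rcases le_or_gt n p with h | h
  · obtain ⟨a, rfl⟩ := le_iff_exists_add.1 h
    obtain ⟨c, hc⟩ := exists_code (a + a) m
    refine ⟨c, ?_⟩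
    rw [decode_eq (r := ⟨a, 0, d⟩) ⟨a + a, m, hc, hm, .inl ⟨rfl, rfl⟩⟩]
    exact ⟨rfl, by ring⟩
  · obtain ⟨a, rfl⟩ := exists_add_one_add _ h
    -- The numerator is `-(a + 1)`, and a numerator `-p` is represented by the odd number `2p - 1`.
    obtain ⟨c, hc⟩ := exists_code (a + a + 1) m
    refine ⟨c, ?_⟩
    rw [decode_eq (r := ⟨0, a + 1, d⟩) ⟨a + a + 1, m, hc, hm, .inr ⟨by ring, rfl⟩⟩]
    exact ⟨rfl, by ring⟩

/-! ## Arithmetical predicates about sequences of rationals -/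

section SeqTerm

variable {Γ : List FType}

/-- Choice of numbers depending on numbers. -/
theorem Arith.exists_choice_nat {P : M.D .nat → M.D .nat → Prop}
    (hP : Arith (Γ := [.nat, .nat]) fun e => P e.1 e.2.1) (h : ∀ x, ∃ y, P y x) :
    ∃ f : M.D .one, ∀ x, P (M.app f x) x := by
  obtain ⟨F, hF, hPF⟩ := hP
  obtain ⟨G, hG, e₁⟩ := hF.exists_lam rca
  -- Choice is available for type `1` arguments, so a number is passed as a constant function and
  -- read off at `0`.
  have hP' : Arith (M := M) (Γ := [.nat, .one]) fun e => P e.1 (M.app e.2.1 0) := by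
    obtain ⟨H, -, e₂⟩ := hG.exists_lam rca
    refine (Arith.eq (F := fun e : M.Env [.nat, .one] =>
      M.app (M.app (H PUnit.unit) (M.app e.2.1 0)) e.1) (.app (.app (.const _)
        (.app .var₁ (.const 0))) .var₀) (.const 1)).congr fun e => ?_
    rw [show M.app (M.app (H PUnit.unit) (M.app e.2.1 0)) e.1 = F (e.1, M.app e.2.1 0, PUnit.unit)
      from (e₂ PUnit.unit (M.app e.2.1 0) e.1).trans (e₁ (_, PUnit.unit) e.1)]
    exact (hPF (e.1, M.app e.2.1 0, PUnit.unit)).2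
  obtain ⟨Y, hY⟩ := Arith.exists_choice (P := fun y x => P y (M.app x 0)) hP' fun x => h _
  obtain ⟨f, -, hf⟩ := IsTerm.exists_lam (M := M) (Γ := []) rca
    (F := fun e : M.Env [.nat] => M.app Y (M.app (M.const (.combPi .nat .nat)) e.1))
    (.app (.const _) (.app (.const _) .var₀))
  refine ⟨f PUnit.unit, fun x => ?_⟩
  rw [show M.app (f PUnit.unit) x = _ from hf PUnit.unit x]
  have := hY (M.app (M.const (.combPi .nat .nat)) x)
  rwa [show M.app (M.app (M.const (.combPi .nat .nat)) x) 0 = x from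
    (rca (M := M)).combPi_eq .nat .nat x 0] at this

/-- The sequences of fractions given by terms with parameters. -/
def IsSeqTerm (X : M.Env Γ → M.D .nat → M.Frac) : Prop :=
  IsTerm (Γ := .nat :: Γ) (fun e => (X e.2 e.1).pos) ∧
    IsTerm (Γ := .nat :: Γ) (fun e => (X e.2 e.1).neg) ∧
    IsTerm (Γ := .nat :: Γ) (fun e => (X e.2 e.1).den)

/-- Decoding is defined by an external choice operator. Being a code is arithmetical, so three
successive internal choices produce the components, and uniqueness of the coded fraction identifies
them with the external ones. -/
theorem exists_decode_term : ∃ p n d : M.D .one, ∀ c,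
    M.decode c = ⟨M.app p c, M.app n c, M.app d c⟩ := by
  have key : ∀ {Δ : List FType} {p n d c : M.Env Δ → M.D .nat}, IsTerm p → IsTerm n → IsTerm d →
      IsTerm c → Arith fun e => M.Codes (c e) ⟨p e, n e, d e⟩ := by
    intro Δ p n d c hp hn hd hc
    refine Arith.ex ?_
    refine Arith.ex (Γ := .nat :: Δ) ?_
    have hp' := hp.weaken (σ := .nat) |>.weaken (σ := .nat)
    have hn' := hn.weaken (σ := .nat) |>.weaken (σ := .nat)
    have hd' := hd.weaken (σ := .nat) |>.weaken (σ := .nat)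
    have hc' := hc.weaken (σ := .nat) |>.weaken (σ := .nat)
    exact (Arith.eq (hc'.add hc') (.add (.mul (.add .var₁ .var₀)
      (.add (.add .var₁ .var₀) (.const 1))) (.add .var₁ .var₁))).and
      ((Arith.eq hd' (.add .var₀ (.const 1))).and
      (((Arith.eq .var₁ (hp'.add hp')).and (.eq hn' (.const 0))).or
      ((Arith.eq (.add .var₁ (.const 1)) (hn'.add hn')).and (.eq hp' (.const 0)))))
  obtain ⟨p, hp⟩ := Arith.exists_choice_nat
    (P := fun y x => ∃ n d, M.Codes x ⟨y, n, d⟩)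
    (by
      exact Arith.ex
        (Arith.ex (key .var₂ .var₁ .var₀ .var₃)))
    fun x => ⟨_, _, _, codes_decode x⟩
  obtain ⟨n, hn⟩ := Arith.exists_choice_nat
    (P := fun y x => ∃ d, M.Codes x ⟨M.app p x, y, d⟩)
    (by
      exact Arith.ex
        (key (.app (.const p) .var₂) .var₁ .var₀ .var₂)) hp
  obtain ⟨d, hd⟩ := Arith.exists_choice_nat
    (P := fun y x => M.Codes x ⟨M.app p x, M.app n x, y⟩)
    (key (.app (.const p) .var₁) (.app (.const n) .var₁) .var₀ .var₁) hn
  exact ⟨p, n, d, fun c => decode_eq (hd c)⟩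

namespace IsSeqTerm

variable {X Y : M.Env Γ → M.D .nat → M.Frac}

omit hM in
theorem weaken {σ : FType} (h : IsSeqTerm X) :
    IsSeqTerm (Γ := σ :: Γ) fun e => X e.2 :=
  ⟨h.1.weaken₁, h.2.1.weaken₁, h.2.2.weaken₁⟩

theorem val {F : M.Env Γ → M.D .one} (hF : IsTerm F) : IsSeqTerm fun e => M.val (F e) := by
  obtain ⟨p, n, d, h⟩ := exists_decode_term (M := M)
  have h' : IsTerm (Γ := .nat :: Γ) fun e => M.app (F e.2) e.1 := hF.weaken.app .var₀
  unfold IsSeqTerm Structure.val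
  simp only [h]
  exact ⟨(IsTerm.const p).app h', (IsTerm.const n).app h', (IsTerm.const d).app h'⟩

omit hM in
theorem cst {p n d : M.Env Γ → M.D .nat} (hp : IsTerm p) (hn : IsTerm n) (hd : IsTerm d) :
    IsSeqTerm fun e => M.cst ⟨p e, n e, d e⟩ :=
  ⟨hp.weaken, hn.weaken, hd.weaken⟩

omit hM in
theorem add (hX : IsSeqTerm X) (hY : IsSeqTerm Y) : IsSeqTerm fun e => X e + Y e :=
  ⟨(hX.1.mul hY.2.2).add (hY.1.mul hX.2.2), (hX.2.1.mul hY.2.2).add (hY.2.1.mul hX.2.2),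
    hX.2.2.mul hY.2.2⟩

omit hM in
theorem sub (hX : IsSeqTerm X) (hY : IsSeqTerm Y) : IsSeqTerm fun e => X e - Y e :=
  ⟨(hX.1.mul hY.2.2).add (hY.2.1.mul hX.2.2), (hX.2.1.mul hY.2.2).add (hY.1.mul hX.2.2),
    hX.2.2.mul hY.2.2⟩

end IsSeqTerm

end SeqTerm

end HigherOrderArithmetic.Structure

namespace HigherOrderArithmetic.Structure

open Filter

variable {M : Structure.{u}} [hM : Fact M.ModelsACA0ω]

/-! ## The ordered ring containing the reals of a model -/

/-- The rational given by a fraction with positive denominator. -/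
noncomputable def Frac.toQ (r : M.Frac) : FracDiff (M.D .nat) :=
  if h : 0 < r.den then .mk r.pos r.neg r.den h else 0

namespace Frac

theorem toQ_eq {p n d : M.D .nat} (h : 0 < d) :
    Frac.toQ (⟨p, n, d⟩ : M.Frac) = FracDiff.mk p n d h := dif_pos h

theorem toQ_add {r s : M.Frac} (hr : 0 < r.den) (hs : 0 < s.den) :
    (r + s).toQ = r.toQ + s.toQ := by
  obtain ⟨p, n, d⟩ := r
  obtain ⟨p', n', d'⟩ := s
  rw [toQ_eq hr, toQ_eq hs, FracDiff.mk_add_mk]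
  exact toQ_eq (mul_pos hr hs)

theorem toQ_sub {r s : M.Frac} (hr : 0 < r.den) (hs : 0 < s.den) :
    (r - s).toQ = r.toQ - s.toQ := by
  obtain ⟨p, n, d⟩ := r
  obtain ⟨p', n', d'⟩ := s
  rw [toQ_eq hr, toQ_eq hs, FracDiff.mk_sub_mk]
  exact toQ_eq (mul_pos hr hs)

theorem lt_iff {r s : M.Frac} (hr : 0 < r.den) (hs : 0 < s.den) :
    r.Lt s ↔ r.toQ < s.toQ := by
  obtain ⟨p, n, d⟩ := r
  obtain ⟨p', n', d'⟩ := s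
  rw [toQ_eq hr, toQ_eq hs, FracDiff.mk_lt_mk, add_comm (p' * d)]
  rw [add_comm (n * d')]
  rfl

theorem add_den_pos {r s : M.Frac} (hr : 0 < r.den) (hs : 0 < s.den) : 0 < (r + s).den :=
  mul_pos hr hs

theorem sub_den_pos {r s : M.Frac} (hr : 0 < r.den) (hs : 0 < s.den) : 0 < (r - s).den :=
  mul_pos hr hs

theorem exists_decode_toQ (q : FracDiff (M.D .nat)) : ∃ c, (M.decode c).toQ = q := by
  induction q using FracDiff.ind with | _ p n d hd
  obtain ⟨c, h, h'⟩ := exists_decode_eq p n d hd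
  refine ⟨c, ?_⟩
  rw [toQ, dif_pos (decode_den_pos c), FracDiff.mk_eq_mk, h]
  linear_combination d * h'

end Frac

variable (M) in
/-- The rational `2 ^ (-n)`. -/
noncomputable def epsQ (n : M.D .nat) : FracDiff (M.D .nat) := (M.eps n).toQ

theorem epsQ_eq (n : M.D .nat) : M.epsQ n = FracDiff.mk 1 0 (M.pow2 n) (pow2_pos n) :=
  Frac.toQ_eq _

theorem epsQ_pos (n : M.D .nat) : 0 < M.epsQ n := by
  rw [epsQ_eq, FracDiff.zero_def, FracDiff.mk_lt_mk]
  simp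

theorem epsQ_add_self (n : M.D .nat) : M.epsQ (n + 1) + M.epsQ (n + 1) = M.epsQ n := by
  rw [epsQ_eq, epsQ_eq, FracDiff.mk_add_mk, FracDiff.mk_eq_mk, pow2_succ]
  ring

theorem epsQ_add_le (n i : M.D .nat) : M.epsQ (n + i) ≤ M.epsQ n := by
  rw [epsQ_eq, epsQ_eq, FracDiff.mk_le_mk]
  simpa using pow2_le_pow2_add n i

theorem exists_epsQ_lt {q : FracDiff (M.D .nat)} (hq : 0 < q) : ∃ l, M.epsQ l < q := by
  induction q using FracDiff.ind with | _ p n d hd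
  rw [FracDiff.zero_def, FracDiff.mk_lt_mk] at hq
  have h : n < p := by simpa using hq
  -- A positive fraction with denominator `d` is at least `1 / d`, and `d < 2 ^ d`.
  refine ⟨d, ?_⟩
  rw [epsQ_eq, FracDiff.mk_lt_mk]
  have h1 := mul_le_mul_of_nonneg_right (add_one_le_iff.2 h) (nat_nonneg (M.pow2 d))
  have h2 := lt_pow2 d
  rw [zero_mul, add_zero]
  refine lt_of_lt_of_le ?_ h1
  rw [one_mul, add_mul, one_mul, add_comm]
  exact add_lt_add_right h2 _

variable (M) in
/-- A nonprincipal ultrafilter on the numbers of the model. -/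
noncomputable def numbersUltrafilter : Ultrafilter (M.D .nat) := Ultrafilter.of atTop

/-- Constant sequences. -/
noncomputable def constGerm :
    FracDiff (M.D .nat) →+*o (M.numbersUltrafilter : Filter (M.D .nat)).Germ
      (FracDiff (M.D .nat)) where
  toFun q := (q : Germ _ _)
  map_zero' := rfl
  map_one' := rfl
  map_add' _ _ := rfl
  map_mul' _ _ := rfl
  monotone' _ _ h := Germ.const_le h

variable (M) in
/-- An ordered ring containing the reals of the model. -/
abbrev R : Type u := StdPart (constGerm (M := M))

theorem constGerm_mem (q : FracDiff (M.D .nat)) : constGerm q ∈ finiteElements (constGerm (M := M)) :=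
  ⟨|q|, by
    rw [abs_le, ← map_neg]
    exact ⟨constGerm.monotone' (neg_abs_le q), constGerm.monotone' (le_abs_self q)⟩⟩

/-- The inclusion of the rationals. -/
noncomputable def ofQ : FracDiff (M.D .nat) →+* M.R :=
  (StdPart.mk constGerm).comp
    ((constGerm (M := M) : FracDiff (M.D .nat) →+* _).codRestrict _ constGerm_mem)

theorem constGerm_lt {q r : FracDiff (M.D .nat)} : constGerm q < constGerm r ↔ q < r := by
  rw [← sub_pos, ← map_sub]
  refine ⟨fun h => ?_, fun h => map_pos_of_pos (sub_pos.2 h)⟩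
  by_contra! h'
  have : constGerm (r - q) ≤ constGerm 0 := constGerm.monotone' (sub_nonpos.2 h')
  rw [map_zero] at this
  exact absurd h (not_lt.2 this)

theorem ofQ_lt {q r : FracDiff (M.D .nat)} : ofQ q < ofQ r ↔ q < r := by
  change StdPart.mk _ _ < StdPart.mk _ _ ↔ _
  rw [StdPart.mk_lt_mk]
  constructor
  · rintro ⟨ε, hε, h⟩
    change constGerm q + constGerm ε < constGerm r at h
    rw [← map_add, constGerm_lt] at h
    exact (lt_add_of_pos_right _ hε).trans h
  · intro h
    refine ⟨(r - q) / 2, half_pos (sub_pos.2 h), ?_⟩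
    change constGerm q + constGerm _ < constGerm r
    rw [← map_add, constGerm_lt]
    linarith

theorem ofQ_le {q r : FracDiff (M.D .nat)} : ofQ q ≤ ofQ r ↔ q ≤ r := by
  rw [← not_lt, ofQ_lt, not_lt]

variable (M) in
/-- The number `2 ^ (-n)`. -/
noncomputable def epsR (n : M.D .nat) : M.R := ofQ (M.epsQ n)

theorem epsR_pos (n : M.D .nat) : 0 < M.epsR n := by
  rw [epsR, ← map_zero ofQ, ofQ_lt]
  exact epsQ_pos n

theorem epsR_add_self (n : M.D .nat) : M.epsR (n + 1) + M.epsR (n + 1) = M.epsR n := by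
  rw [epsR, ← map_add, epsQ_add_self, epsR]

theorem epsR_add_le (n i : M.D .nat) : M.epsR (n + i) ≤ M.epsR n :=
  ofQ_le.2 (epsQ_add_le n i)

theorem epsR_le_of_le {m n : M.D .nat} (h : m ≤ n) : M.epsR n ≤ M.epsR m := by
  obtain ⟨i, rfl⟩ := le_iff_exists_add.1 h
  exact epsR_add_le m i

theorem exists_epsR_lt {r : M.R} (hr : 0 < r) : ∃ l, M.epsR l < r := by
  obtain ⟨x, rfl⟩ := StdPart.mk_surjective r
  obtain ⟨ε, hε, h⟩ := StdPart.mk_pos.1 hr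
  obtain ⟨l, hl⟩ := exists_epsQ_lt hε
  refine ⟨l, StdPart.mk_lt_mk.2 ⟨ε - M.epsQ l, sub_pos.2 hl, ?_⟩⟩
  change constGerm _ + constGerm _ < _
  rwa [← map_add, add_sub_cancel]

/-! ## Limits of sequences of rationals -/

/-- Cauchy sequences of rationals. -/
def Conv (X : M.D .nat → M.Frac) : Prop :=
  (∀ n, 0 < (X n).den) ∧
    ∀ ε, 0 < ε → ∃ n, ∀ m, n ≤ m → ∀ m', n ≤ m' → (X m).toQ - (X m').toQ < ε

/-- The class of a sequence of rationals. -/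
noncomputable def germ (X : M.D .nat → M.Frac) :
    (M.numbersUltrafilter : Filter (M.D .nat)).Germ (FracDiff (M.D .nat)) :=
  ((fun n => (X n).toQ : M.D .nat → FracDiff (M.D .nat)) : Germ _ _)

theorem eventually_of_le {P : M.D .nat → Prop} (n : M.D .nat) (h : ∀ m, n ≤ m → P m) :
    ∀ᶠ m in (M.numbersUltrafilter : Filter (M.D .nat)), P m :=
  (Ultrafilter.of_le atTop) ((eventually_ge_atTop n).mono h)

theorem germ_lt_of_le {X : M.D .nat → M.Frac} {q : FracDiff (M.D .nat)} (n : M.D .nat)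
    (h : ∀ m, n ≤ m → (X m).toQ < q) : germ X < constGerm q :=
  Germ.coe_lt.2 (eventually_of_le n h)

theorem lt_germ_of_le {X : M.D .nat → M.Frac} {q : FracDiff (M.D .nat)} (n : M.D .nat)
    (h : ∀ m, n ≤ m → q < (X m).toQ) : constGerm q < germ X :=
  Germ.coe_lt.2 (eventually_of_le n h)

theorem Conv.germ_mem {X : M.D .nat → M.Frac} (h : Conv X) :
    germ X ∈ finiteElements (constGerm (M := M)) := by
  obtain ⟨n, hn⟩ := h.2 1 one_pos
  have h1 : germ X < constGerm ((X n).toQ + 1) := germ_lt_of_le n fun m hm => by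
    have := hn m hm n le_rfl
    linarith
  have h2 : constGerm ((X n).toQ - 1) < germ X := lt_germ_of_le n fun m hm => by
    have := hn n le_rfl m hm
    linarith
  have h3 : constGerm ((X n).toQ - 1) ∈ finiteElements (constGerm (M := M)) := constGerm_mem _
  have h4 : constGerm ((X n).toQ + 1) ∈ finiteElements (constGerm (M := M)) := constGerm_mem _
  obtain ⟨k, hk⟩ := h3
  obtain ⟨k', hk'⟩ := h4
  refine ⟨max k k', abs_le.2 ⟨?_, ?_⟩⟩
  · have := neg_le_of_abs_le hk
    have h5 : constGerm k ≤ constGerm (max k k') := constGerm.monotone' (le_max_left _ _)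
    linarith
  · have := le_of_abs_le hk'
    have h5 : constGerm k' ≤ constGerm (max k k') := constGerm.monotone' (le_max_right _ _)
    linarith

open Classical in
/-- The limit of a Cauchy sequence. -/
noncomputable def lim (X : M.D .nat → M.Frac) : M.R :=
  if h : Conv X then StdPart.mk _ ⟨germ X, h.germ_mem⟩ else 0

theorem Conv.lim_eq {X : M.D .nat → M.Frac} (h : Conv X) :
    lim X = StdPart.mk _ ⟨germ X, h.germ_mem⟩ := dif_pos h

section Limits

variable {X Y : M.D .nat → M.Frac}

theorem Conv.add (hX : Conv X) (hY : Conv Y) : Conv (X + Y) := by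
  refine ⟨fun n => Frac.add_den_pos (hX.1 n) (hY.1 n), fun ε hε => ?_⟩
  obtain ⟨n, hn⟩ := hX.2 _ (half_pos hε)
  obtain ⟨n', hn'⟩ := hY.2 _ (half_pos hε)
  refine ⟨max n n', fun m hm m' hm' => ?_⟩
  rw [Pi.add_apply, Pi.add_apply, Frac.toQ_add (hX.1 _) (hY.1 _), Frac.toQ_add (hX.1 _) (hY.1 _)]
  have h1 := hn m (le_of_max_le_left hm) m' (le_of_max_le_left hm')
  have h2 := hn' m (le_of_max_le_right hm) m' (le_of_max_le_right hm')
  linarith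

theorem Conv.sub (hX : Conv X) (hY : Conv Y) : Conv (X - Y) := by
  refine ⟨fun n => Frac.sub_den_pos (hX.1 n) (hY.1 n), fun ε hε => ?_⟩
  obtain ⟨n, hn⟩ := hX.2 _ (half_pos hε)
  obtain ⟨n', hn'⟩ := hY.2 _ (half_pos hε)
  refine ⟨max n n', fun m hm m' hm' => ?_⟩
  rw [Pi.sub_apply, Pi.sub_apply, Frac.toQ_sub (hX.1 _) (hY.1 _), Frac.toQ_sub (hX.1 _) (hY.1 _)]
  have h1 := hn m (le_of_max_le_left hm) m' (le_of_max_le_left hm')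
  have h2 := hn' m' (le_of_max_le_right hm') m (le_of_max_le_right hm)
  linarith

theorem Conv.lim_add (hX : Conv X) (hY : Conv Y) : lim (X + Y) = lim X + lim Y := by
  rw [hX.lim_eq, hY.lim_eq, (hX.add hY).lim_eq, ← map_add]
  congr 2
  exact Germ.coe_eq.2 (.of_forall fun n => Frac.toQ_add (hX.1 n) (hY.1 n))

theorem Conv.lim_sub (hX : Conv X) (hY : Conv Y) : lim (X - Y) = lim X - lim Y := by
  rw [hX.lim_eq, hY.lim_eq, (hX.sub hY).lim_eq, ← map_sub]
  congr 2
  exact Germ.coe_eq.2 (.of_forall fun n => Frac.toQ_sub (hX.1 n) (hY.1 n))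

theorem conv_cst {r : M.Frac} (hr : 0 < r.den) : Conv (M.cst r) :=
  ⟨fun _ => hr, fun ε hε => ⟨0, fun m _ m' _ => by simpa [cst] using hε⟩⟩

theorem lim_cst {r : M.Frac} (hr : 0 < r.den) : lim (M.cst r) = ofQ r.toQ :=
  (conv_cst hr).lim_eq

theorem eps_den_pos (l : M.D .nat) : 0 < (M.eps l).den := pow2_pos l

theorem conv_eps (l : M.D .nat) : Conv (M.cst (M.eps l)) := conv_cst (eps_den_pos l)

theorem lim_eps (l : M.D .nat) : lim (M.cst (M.eps l)) = M.epsR l := lim_cst (eps_den_pos l)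

/-- The bridge between internal and external order. The ultrafilter contains all tails, so an
eventual gap survives. In return, a gap in the ring holds at some arbitrarily late index, and the
Cauchy property spreads it to a whole tail. -/
theorem Conv.rlt_iff (hX : Conv X) (hY : Conv Y) : M.RLt X Y ↔ lim X < lim Y := by
  rw [hX.lim_eq, hY.lim_eq, StdPart.mk_lt_mk]
  constructor
  · rintro ⟨l, K, h⟩
    refine ⟨M.epsQ l, epsQ_pos l, Germ.coe_lt.2 (eventually_of_le K fun m hm => ?_)⟩
    obtain ⟨i, rfl⟩ := le_iff_exists_add.1 hm
    have := (Frac.lt_iff (Frac.add_den_pos (hX.1 _) (eps_den_pos l)) (hY.1 _)).1 (h i)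
    rwa [Frac.toQ_add (hX.1 _) (eps_den_pos l)] at this
  · rintro ⟨ε, hε, h⟩
    -- Moving the gap `ε` to another index costs `ε / 4` for each sequence; the remaining `ε / 2`
    -- leaves room for `2 ^ (-l)`.
    obtain ⟨n, hn⟩ := hX.2 _ (div_pos hε (by norm_num : (0 : FracDiff (M.D .nat)) < 4))
    obtain ⟨n', hn'⟩ := hY.2 _ (div_pos hε (by norm_num : (0 : FracDiff (M.D .nat)) < 4))
    obtain ⟨k, hk, hk'⟩ := ((Germ.coe_lt.1 h).and
      (eventually_of_le (M := M) (max n n') fun m hm => hm)).exists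
    obtain ⟨l, hl⟩ := exists_epsQ_lt (half_pos hε)
    refine ⟨l, max n n', fun i => ?_⟩
    rw [Frac.lt_iff (Frac.add_den_pos (hX.1 _) (eps_den_pos l)) (hY.1 _),
      Frac.toQ_add (hX.1 _) (eps_den_pos l)]
    have h1 := hn (max n n' + i) ((le_max_left _ _).trans le_self_add) k (le_of_max_le_left hk')
    have h2 := hn' k (le_of_max_le_right hk') (max n n' + i)
      ((le_max_right _ _).trans le_self_add)
    change (X k).toQ + ε < (Y k).toQ at hk
    change _ + M.epsQ l < _
    linarith

theorem Conv.rle_iff (hX : Conv X) (hY : Conv Y) : M.RLe X Y ↔ lim X ≤ lim Y := by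
  rw [RLe, hY.rlt_iff hX, not_lt]

end Limits

/-! ## Reals -/

section Reals

variable {x y : M.D .one}

theorem val_den_pos (x : M.D .one) (n : M.D .nat) : 0 < (M.val x n).den := decode_den_pos _

theorem isReal_iff : M.IsReal x ↔ ∀ n i, |(M.val x n).toQ - (M.val x (n + i)).toQ| < M.epsQ n := by
  refine forall_congr' fun n => forall_congr' fun i => ?_
  rw [Frac.lt_iff (Frac.sub_den_pos (val_den_pos _ _) (val_den_pos _ _)) (eps_den_pos n),
    Frac.lt_iff (Frac.sub_den_pos (val_den_pos _ _) (val_den_pos _ _)) (eps_den_pos n),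
    Frac.toQ_sub (val_den_pos _ _) (val_den_pos _ _),
    Frac.toQ_sub (val_den_pos _ _) (val_den_pos _ _), abs_lt]
  change _ < M.epsQ n ∧ _ < M.epsQ n ↔ _
  constructor
  · rintro ⟨h, h'⟩
    exact ⟨by linarith, h⟩
  · rintro ⟨h, h'⟩
    exact ⟨h', by linarith⟩

theorem IsReal.conv (h : M.IsReal x) : Conv (M.val x) := by
  refine ⟨val_den_pos x, fun ε hε => ?_⟩
  rw [isReal_iff] at h
  obtain ⟨n, hn⟩ := exists_epsQ_lt (half_pos hε)
  refine ⟨n, fun m hm m' hm' => ?_⟩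
  obtain ⟨i, rfl⟩ := le_iff_exists_add.1 hm
  obtain ⟨i', rfl⟩ := le_iff_exists_add.1 hm'
  have h1 := abs_lt.1 (h n i)
  have h2 := abs_lt.1 (h n i')
  linarith

variable (M) in
/-- The real number given by a type `1` object. -/
noncomputable def toR (x : M.D .one) : M.R := lim (M.val x)

theorem IsReal.abs_sub_le (h : M.IsReal x) (n : M.D .nat) :
    |M.toR x - ofQ (M.val x n).toQ| ≤ M.epsR n := by
  have hc := conv_cst (val_den_pos x n)
  have h0 := isReal_iff.1 h n
  have h1 : ¬ M.RLt (M.cst (M.eps n)) (M.val x - M.cst (M.val x n)) := by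
    rintro ⟨l, K, h1⟩
    -- The index `K + n` is beyond both `K` and `n`, so that fast convergence applies to it.
    have : (M.eps n + M.eps l).Lt (M.val x (K + n) - M.val x n) := h1 n
    rw [Frac.lt_iff (Frac.add_den_pos (eps_den_pos n) (eps_den_pos l))
      (Frac.sub_den_pos (val_den_pos _ _) (val_den_pos _ _)), Frac.toQ_add (eps_den_pos n) (eps_den_pos l),
      Frac.toQ_sub (val_den_pos _ _) (val_den_pos _ _), add_comm K n] at this
    change M.epsQ n + M.epsQ l < _ - (M.val x n).toQ at this
    have h2 := abs_lt.1 (h0 K)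
    have := epsQ_pos l
    linarith
  have h2 : ¬ M.RLt (M.cst (M.eps n)) (M.cst (M.val x n) - M.val x) := by
    rintro ⟨l, K, h1⟩
    have : (M.eps n + M.eps l).Lt (M.val x n - M.val x (K + n)) := h1 n
    rw [Frac.lt_iff (Frac.add_den_pos (eps_den_pos n) (eps_den_pos l))
      (Frac.sub_den_pos (val_den_pos _ _) (val_den_pos _ _)), Frac.toQ_add (eps_den_pos n) (eps_den_pos l),
      Frac.toQ_sub (val_den_pos _ _) (val_den_pos _ _), add_comm K n] at this
    change M.epsQ n + M.epsQ l < (M.val x n).toQ - _ at this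
    have h2 := abs_lt.1 (h0 K)
    have := epsQ_pos l
    linarith
  rw [(conv_eps n).rlt_iff (h.conv.sub hc), h.conv.lim_sub hc, lim_eps,
    lim_cst (val_den_pos x n)] at h1
  rw [(conv_eps n).rlt_iff (hc.sub h.conv), hc.lim_sub h.conv, lim_eps,
    lim_cst (val_den_pos x n)] at h2
  rw [not_lt] at h1 h2
  exact abs_le.2 ⟨by unfold toR; linarith, h1⟩

theorem realEq_iff (hx : M.IsReal x) (hy : M.IsReal y) : M.RealEq x y ↔ M.toR x = M.toR y := by
  have key : M.RealEq x y ↔ ∀ n, |ofQ (M.val x n).toQ - ofQ (M.val y n).toQ| ≤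
      M.epsR n + M.epsR n := by
    refine forall_congr' fun n => ?_
    rw [Frac.lt_iff (Frac.add_den_pos (eps_den_pos n) (eps_den_pos n))
      (Frac.sub_den_pos (val_den_pos _ _) (val_den_pos _ _)),
      Frac.lt_iff (Frac.add_den_pos (eps_den_pos n) (eps_den_pos n))
      (Frac.sub_den_pos (val_den_pos _ _) (val_den_pos _ _)),
      Frac.toQ_add (eps_den_pos n) (eps_den_pos n),
      Frac.toQ_sub (val_den_pos _ _) (val_den_pos _ _),
      Frac.toQ_sub (val_den_pos _ _) (val_den_pos _ _), not_lt, not_lt, ← ofQ_le, ← ofQ_le,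
      map_add, map_sub, map_sub, abs_le]
    change _ ≤ M.epsR n + M.epsR n ∧ _ ≤ M.epsR n + M.epsR n ↔ _
    constructor
    · rintro ⟨h, h'⟩
      exact ⟨by linarith, h⟩
    · rintro ⟨h, h'⟩
      exact ⟨h', by linarith⟩
  rw [key]
  constructor
  · intro h
    by_contra hne
    obtain ⟨l, hl⟩ := exists_epsR_lt (abs_pos.2 (sub_ne_zero.2 hne))
    -- With `δ = 2 ^ (-(l + 2))` the errors are `δ` and `δ` for the approximations and `2δ` between
    -- them, in total `2 ^ (-l)`.
    have h1 := abs_le.1 (hx.abs_sub_le (l + 1 + 1))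
    have h2 := abs_le.1 (hy.abs_sub_le (l + 1 + 1))
    have h3 := abs_le.1 (h (l + 1 + 1))
    have h4 := epsR_add_self l
    have h5 := epsR_add_self (l + 1)
    refine absurd hl (not_lt.2 (abs_le.2 ⟨?_, ?_⟩)) <;> linarith
  · intro h n
    have h1 := abs_le.1 (hx.abs_sub_le n)
    have h2 := abs_le.1 (hy.abs_sub_le n)
    exact abs_le.2 ⟨by linarith, by linarith⟩

theorem close_iff (hx : M.IsReal x) (hy : M.IsReal y) {k : M.D .nat} :
    M.Close x y k ↔ |M.toR x - M.toR y| < M.epsR k := by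
  rw [Close, (hx.conv.sub hy.conv).rlt_iff (conv_eps k), (hy.conv.sub hx.conv).rlt_iff (conv_eps k),
    hx.conv.lim_sub hy.conv, hy.conv.lim_sub hx.conv, lim_eps, abs_lt]
  change M.toR x - M.toR y < _ ∧ M.toR y - M.toR x < _ ↔ _
  constructor
  · rintro ⟨h, h'⟩
    exact ⟨by linarith, h⟩
  · rintro ⟨h, h'⟩
    exact ⟨h', by linarith⟩

theorem inUnit_iff (hx : M.IsReal x) : M.InUnit x ↔ 0 ≤ M.toR x ∧ M.toR x ≤ 1 := by
  have h0 : 0 < (0 : M.Frac).den := one_pos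
  have h1 : 0 < (1 : M.Frac).den := one_pos
  have e0 : (0 : M.Frac).toQ = 0 := Frac.toQ_eq _
  have e1 : (1 : M.Frac).toQ = 1 := Frac.toQ_eq _
  rw [InUnit, (conv_cst h0).rle_iff hx.conv, hx.conv.rle_iff (conv_cst h1), lim_cst h0, lim_cst h1,
    e0, e1, map_zero, map_one]
  exact and_iff_right hx

variable (M) in
/-- The real given by the rational with code `c`. -/
def ratReal (c : M.D .nat) : M.D .one := M.app (M.const (.combPi .nat .nat)) c

theorem val_ratReal (c : M.D .nat) : M.val (M.ratReal c) = M.cst (M.decode c) :=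
  funext fun n => congrArg M.decode ((rca (M := M)).combPi_eq .nat .nat c n)

theorem isReal_of_val_eq_cst {c : M.D .nat} (h : M.val x = M.cst (M.decode c)) : M.IsReal x := by
  rw [isReal_iff]
  intro n i
  rw [h]
  simpa [cst] using epsQ_pos n

theorem toR_of_val_eq_cst {c : M.D .nat} (h : M.val x = M.cst (M.decode c)) :
    M.toR x = ofQ (M.decode c).toQ := by
  rw [toR, h, lim_cst (decode_den_pos c)]

theorem isReal_ratReal (c : M.D .nat) : M.IsReal (M.ratReal c) :=
  isReal_of_val_eq_cst (val_ratReal c)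

theorem toR_ratReal (c : M.D .nat) : M.toR (M.ratReal c) = ofQ (M.decode c).toQ :=
  toR_of_val_eq_cst (val_ratReal c)

end Reals

end HigherOrderArithmetic.Structure

namespace HigherOrderArithmetic.Structure

variable {M : Structure.{u}} [hM : Fact M.ModelsACA0ω]

/-! ## Arithmetical predicates of real numbers -/

section ArithReal

variable {Γ : List FType} {X Y : M.Env Γ → M.D .nat → M.Frac} {F G : M.Env Γ → M.D .one}
  {k : M.Env Γ → M.D .nat}

theorem Arith.fracLt {p n d p' n' d' : M.Env Γ → M.D .nat} (hp : IsTerm p) (hn : IsTerm n)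
    (hd : IsTerm d) (hp' : IsTerm p') (hn' : IsTerm n') (hd' : IsTerm d') :
    Arith fun e => Frac.Lt (⟨p e, n e, d e⟩ : M.Frac) ⟨p' e, n' e, d' e⟩ :=
  .lt ((hp.mul hd').add (hn'.mul hd)) ((hp'.mul hd).add (hn.mul hd'))

omit hM in
theorem IsSeqTerm.eps (hk : IsTerm k) : IsSeqTerm fun e => M.cst (M.eps (k e)) :=
  IsSeqTerm.cst (.const 1) (.const 0) hk.pow2

omit hM in
/-- Substitution for the first variable. -/
theorem IsTerm.subst {σ τ : FType} {F : M.Env (σ :: Γ) → M.D τ} (hF : IsTerm F)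
    {G : M.Env Γ → M.D σ} (hG : IsTerm G) : IsTerm fun e => F (G e, e) := by
  suffices H : ∀ {Δ : List FType} {τ : FType} {F : M.Env Δ → M.D τ}, IsTerm F →
      ∀ h : Δ = σ :: Γ, IsTerm fun e => F (h ▸ ((G e, e) : M.Env (σ :: Γ))) from H hF rfl
  intro Δ τ F hF
  induction hF with
  | const c => exact fun _ => .const c
  | app _ _ h₁ h₂ => exact fun h => (h₁ h).app (h₂ h)
  | var v =>
    rintro rfl
    cases v with
    | here => exact hG
    | there v => exact .var v

omit hM in
theorem IsSeqTerm.apply (hX : IsSeqTerm X) (hk : IsTerm k) :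
    IsTerm (fun e => (X e (k e)).pos) ∧ IsTerm (fun e => (X e (k e)).neg) ∧
      IsTerm (fun e => (X e (k e)).den) :=
  ⟨hX.1.subst hk, hX.2.1.subst hk, hX.2.2.subst hk⟩

/-- Comparing reals only quantifies over indices; hence closeness and membership in `[0,1]` are
arithmetical too. -/
theorem Arith.rlt (hX : IsSeqTerm X) (hY : IsSeqTerm Y) : Arith fun e => M.RLt (X e) (Y e) := by
  refine Arith.ex (R := fun l e => ∃ K, ∀ i, (X e (K + i) + M.eps l).Lt (Y e (K + i))) ?_
  refine Arith.ex (Γ := .nat :: Γ) ?_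
  refine Arith.all (Γ := .nat :: .nat :: Γ) ?_
  have hi : IsTerm (M := M) (Γ := .nat :: .nat :: .nat :: Γ) fun e => e.2.1 + e.1 :=
    .add .var₁ .var₀
  obtain ⟨h1, h2, h3⟩ := ((hX.weaken (σ := .nat) |>.weaken (σ := .nat) |>.weaken (σ := .nat)).add
    (.eps .var₂)).apply hi
  obtain ⟨h1', h2', h3'⟩ :=
    (hY.weaken (σ := .nat) |>.weaken (σ := .nat) |>.weaken (σ := .nat)).apply hi
  exact Arith.fracLt h1 h2 h3 h1' h2' h3'

theorem Arith.rle (hX : IsSeqTerm X) (hY : IsSeqTerm Y) : Arith fun e => M.RLe (X e) (Y e) :=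
  (Arith.rlt hY hX).not

theorem Arith.close (hF : IsTerm F) (hG : IsTerm G) (hk : IsTerm k) :
    Arith fun e => M.Close (F e) (G e) (k e) :=
  (Arith.rlt ((IsSeqTerm.val hF).sub (.val hG)) (.eps hk)).and
    (Arith.rlt ((IsSeqTerm.val hG).sub (.val hF)) (.eps hk))

theorem Arith.isReal (hF : IsTerm F) : Arith fun e => M.IsReal (F e) := by
  have hv := IsSeqTerm.val (hF.weaken (σ := .nat) |>.weaken (σ := .nat))
  refine Arith.all (R := fun n e => ∀ i, (M.val (F e) n - M.val (F e) (n + i)).Lt (M.eps n) ∧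
    (M.val (F e) (n + i) - M.val (F e) n).Lt (M.eps n)) ?_
  refine Arith.all (Γ := .nat :: Γ) ?_
  obtain ⟨h1, h2, h3⟩ := hv.apply (k := fun e : M.Env (.nat :: .nat :: Γ) => e.2.1) .var₁
  obtain ⟨h1', h2', h3'⟩ := hv.apply (k := fun e : M.Env (.nat :: .nat :: Γ) => e.2.1 + e.1) (.add .var₁ .var₀)
  exact (Arith.fracLt ((h1.mul h3').add (h2'.mul h3)) ((h2.mul h3').add (h1'.mul h3)) (h3.mul h3')
      (.const 1) (.const 0) (.pow2 .var₁)).and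
    (Arith.fracLt ((h1'.mul h3).add (h2.mul h3')) ((h2'.mul h3).add (h1.mul h3')) (h3'.mul h3)
      (.const 1) (.const 0) (.pow2 .var₁))

theorem Arith.inUnit (hF : IsTerm F) : Arith fun e => M.InUnit (F e) :=
  (Arith.isReal hF).and ((Arith.rle (.cst (.const 0) (.const 0) (.const 1)) (.val hF)).and
    (Arith.rle (.val hF) (.cst (.const 1) (.const 0) (.const 1))))

omit hM in
theorem IsTerm.ratReal (hk : IsTerm k) : IsTerm fun e => M.ratReal (k e) :=
  (IsTerm.const _).app hk

end ArithReal

/-! ## Points of the unit interval -/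

section Points

variable {x y z : M.D .one}

theorem InUnit.nonneg (h : M.InUnit x) : 0 ≤ M.toR x := ((inUnit_iff h.1).1 h).1

theorem InUnit.le_one (h : M.InUnit x) : M.toR x ≤ 1 := ((inUnit_iff h.1).1 h).2

theorem exists_rat (q : FracDiff (M.D .nat)) : ∃ c, M.toR (M.ratReal c) = ofQ q := by
  obtain ⟨c, hc⟩ := Frac.exists_decode_toQ q
  exact ⟨c, by rw [toR_ratReal, hc]⟩

theorem exists_unit_rat {q : FracDiff (M.D .nat)} (h0 : 0 ≤ q) (h1 : q ≤ 1) :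
    ∃ c, M.InUnit (M.ratReal c) ∧ M.toR (M.ratReal c) = ofQ q := by
  obtain ⟨c, hc⟩ := exists_rat q
  refine ⟨c, (inUnit_iff (isReal_ratReal c)).2 ?_, hc⟩
  rw [hc, ← map_zero ofQ, ← map_one ofQ, ofQ_le, ofQ_le]
  exact ⟨h0, h1⟩

theorem exists_ofQ_abs_sub_lt (hx : M.InUnit x) (k : M.D .nat) :
    ∃ q : FracDiff (M.D .nat), 0 ≤ q ∧ q ≤ 1 ∧ |M.toR x - ofQ q| < M.epsR k := by
  have h1 := abs_le.1 (hx.1.abs_sub_le (k + 1))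
  have h2 := epsR_add_self k
  have h3 := epsR_pos (k + 1)
  have hx0 := hx.nonneg
  have hx1 := hx.le_one
  set q := (M.val x (k + 1)).toQ
  rcases lt_or_ge q 0 with hq | hq
  · refine ⟨0, le_rfl, zero_le_one, ?_⟩
    have hq' := ofQ_lt.2 hq
    rw [map_zero] at hq' ⊢
    exact abs_lt.2 ⟨by linarith, by linarith⟩
  · rcases lt_or_ge 1 q with hq2 | hq2
    · refine ⟨1, zero_le_one, le_rfl, ?_⟩
      have hq' := ofQ_lt.2 hq2
      rw [map_one] at hq' ⊢
      exact abs_lt.2 ⟨by linarith, by linarith⟩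
    · exact ⟨q, hq, hq2, abs_lt.2 ⟨by linarith, by linarith⟩⟩

theorem exists_unit_rat_close (hx : M.InUnit x) (k : M.D .nat) :
    ∃ c, M.InUnit (M.ratReal c) ∧ |M.toR x - M.toR (M.ratReal c)| < M.epsR k := by
  obtain ⟨q, h0, h1, h⟩ := exists_ofQ_abs_sub_lt hx k
  obtain ⟨c, hc, e⟩ := exists_unit_rat h0 h1
  exact ⟨c, hc, by rwa [e]⟩

/-- Every ball contains a nondegenerate interval. -/
theorem exists_interval (hx : M.InUnit x) (k : M.D .nat) :
    ∃ c d : M.D .one, M.InUnit c ∧ M.InUnit d ∧ M.toR c < M.toR d ∧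
      ∀ y, M.InUnit y → M.toR c ≤ M.toR y → M.toR y ≤ M.toR d →
        |M.toR x - M.toR y| < M.epsR k := by
  obtain ⟨q, h0, h1, h⟩ := exists_ofQ_abs_sub_lt hx (k + 1)
  have e1 := epsR_add_self k
  have e2 := epsQ_pos (k + 1)
  have e3 : ofQ (M.epsQ (k + 1)) = M.epsR (k + 1) := rfl
  have h' := abs_lt.1 h
  obtain ⟨a, b, ha, hb, hab, haq, hbq⟩ : ∃ a b : FracDiff (M.D .nat), 0 ≤ a ∧ b ≤ 1 ∧ a < b ∧
      q - M.epsQ (k + 1) ≤ a ∧ b ≤ q + M.epsQ (k + 1) := by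
    -- The interval extends to the right of `q`, except at the endpoint `1`, where it extends to the
    -- left.
    rcases lt_or_eq_of_le h1 with hq | rfl
    · exact ⟨q, min 1 (q + M.epsQ (k + 1)), h0, min_le_left _ _, lt_min hq (by linarith),
        by linarith, min_le_right _ _⟩
    · exact ⟨max 0 (1 - M.epsQ (k + 1)), 1, le_max_left _ _, le_rfl,
        max_lt one_pos (by linarith), le_max_right _ _, by linarith⟩
  obtain ⟨c, hc, ec⟩ := exists_unit_rat ha (hab.le.trans hb)
  obtain ⟨d, hd, ed⟩ := exists_unit_rat (ha.trans hab.le) hb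
  refine ⟨_, _, hc, hd, by rwa [ec, ed, ofQ_lt], fun y _ h2 h3 => ?_⟩
  rw [ec] at h2
  rw [ed] at h3
  have h4 := ofQ_le.2 haq
  have h5 := ofQ_le.2 hbq
  rw [map_sub, e3] at h4
  rw [map_add, e3] at h5
  exact abs_lt.2 ⟨by linarith, by linarith⟩

/-- Every nondegenerate interval contains a ball. -/
theorem exists_ball {c d : M.D .one} (hc : M.InUnit c) (hd : M.InUnit d)
    (h : M.toR c < M.toR d) : ∃ (b : M.D .one) (k : M.D .nat), M.InUnit b ∧
      ∀ y, M.InUnit y → |M.toR y - M.toR b| < M.epsR k → M.toR c < M.toR y ∧ M.toR y < M.toR d := by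
  obtain ⟨l, hl⟩ := exists_epsR_lt (sub_pos.2 h)
  obtain ⟨q, h0, h1, hq⟩ := exists_ofQ_abs_sub_lt hc (l + 1 + 1)
  have hq' := abs_lt.1 hq
  have e1 := epsR_add_self l
  have e2 := epsR_add_self (l + 1)
  have e3 := epsR_pos (l + 1 + 1)
  have e4 : ofQ (M.epsQ (l + 1)) = M.epsR (l + 1) := rfl
  have hd1 := hd.le_one
  -- With `δ = 2 ^ (-(l + 2))`, `d - c > 4δ` and `|c - q| < δ`, so `q + 2δ` is more than `δ` away
  -- from `c` and from `d`.
  obtain ⟨b, hb, eb⟩ := exists_unit_rat (M := M) (q := q + M.epsQ (l + 1))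
    (add_nonneg h0 (epsQ_pos _).le) (by
      rw [← ofQ_le, map_add, map_one, e4]
      linarith)
  refine ⟨_, l + 1 + 1, hb, fun y _ hy => ?_⟩
  rw [eb, map_add, e4] at hy
  have hy' := abs_lt.1 hy
  exact ⟨by linarith, by linarith⟩

end Points

/-! ## Numbers as reals -/

/-- The fraction `-n`. -/
def negNat (n : M.D .nat) : M.Frac := ⟨0, n, 1⟩

/-- A number as a real. -/
noncomputable def natR (n : M.D .nat) : M.R := ofQ (FracDiff.mk n 0 1 one_pos)

theorem lim_negNat (n : M.D .nat) : lim (M.cst (negNat n)) = -natR n := by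
  rw [lim_cst (r := negNat n) one_pos, negNat, Frac.toQ_eq one_pos, natR, ← map_neg]
  rfl

theorem conv_negNat (n : M.D .nat) : Conv (M.cst (negNat n)) := conv_cst (r := negNat n) one_pos

theorem natR_add (m n : M.D .nat) : natR (m + n) = natR m + natR n := by
  rw [natR, natR, natR, ← map_add, FracDiff.mk_add_mk]
  congr 1
  rw [FracDiff.mk_eq_mk]
  ring

theorem natR_mul (m n : M.D .nat) : natR (m * n) = natR m * natR n := by
  rw [natR, natR, natR, ← map_mul, FracDiff.mk_mul_mk]
  congr 1
  rw [FracDiff.mk_eq_mk]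
  ring

theorem natR_zero : natR (0 : M.D .nat) = 0 := map_zero ofQ

theorem natR_one : natR (1 : M.D .nat) = 1 := map_one ofQ

theorem natR_lt {m n : M.D .nat} : natR m < natR n ↔ m < n := by
  rw [natR, natR, ofQ_lt, FracDiff.mk_lt_mk]
  simp

theorem natR_le {m n : M.D .nat} : natR m ≤ natR n ↔ m ≤ n := by
  rw [← not_lt, natR_lt, not_lt]

theorem natR_nonneg (n : M.D .nat) : 0 ≤ natR n := by
  rw [← natR_zero, natR_le]
  exact nat_nonneg n

theorem epsR_mul_pow2 (n : M.D .nat) : M.epsR n * natR (M.pow2 n) = 1 := by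
  rw [epsR, natR, ← map_mul, epsQ_eq, FracDiff.mk_mul_mk, ← map_one ofQ]
  congr 1
  rw [FracDiff.one_def, FracDiff.mk_eq_mk]
  ring

theorem exists_lt_natR (q : FracDiff (M.D .nat)) : ∃ n, ofQ q < natR n := by
  induction q using FracDiff.ind with | _ p n d hd
  refine ⟨p + 1, ofQ_lt.2 (FracDiff.mk_lt_mk.2 ?_)⟩
  rw [mul_one, zero_mul, add_zero]
  have h1 : p < p + 1 := lt_add_one p
  have h2 : (p + 1) * 1 ≤ (p + 1) * d :=
    mul_le_mul_of_nonneg_left (by simpa using add_one_le_iff.2 hd) (nat_nonneg _)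
  rw [mul_one] at h2
  exact (h1.trans_le h2).trans_le le_self_add

theorem IsReal.exists_abs_lt {x : M.D .one} (hx : M.IsReal x) : ∃ n, |M.toR x| < natR n := by
  have h1 := abs_le.1 (hx.abs_sub_le 0)
  obtain ⟨n, hn⟩ := exists_lt_natR ((M.val x 0).toQ + M.epsQ 0)
  obtain ⟨m, hm⟩ := exists_lt_natR (-(M.val x 0).toQ + M.epsQ 0)
  rw [map_add] at hn hm
  rw [map_neg] at hm
  have h2 := natR_nonneg n
  have h3 := natR_nonneg m
  refine ⟨n + m, abs_lt.2 ?_⟩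
  rw [natR_add]
  change _ + M.epsR 0 < _ at hn
  change _ + M.epsR 0 < _ at hm
  exact ⟨by linarith, by linarith⟩

/-! ## Upper semi-continuous functions -/

section Usco

variable {f : M.D (.one ⟶ₜ .one)} {x y : M.D .one}

variable (M) in
/-- The value of a function as an element of the ordered ring. -/
noncomputable abbrev valR (f : M.D (.one ⟶ₜ .one)) (x : M.D .one) : M.R := M.toR (M.app f x)

theorem usco_iff (hf : M.IsFun f) : M.Usco f ↔ ∀ x, M.InUnit x → ∀ k, ∃ N, ∀ y, M.InUnit y →
    |M.toR x - M.toR y| < M.epsR N → M.valR f y < M.valR f x + M.epsR k := by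
  rw [Usco, and_iff_right hf]
  refine forall₂_congr fun x hx => forall_congr' fun k => exists_congr fun N =>
    forall₂_congr fun y hy => ?_
  rw [close_iff hx.1 hy.1, (hf.1 y hy).conv.rlt_iff ((hf.1 x hx).conv.add (conv_eps k)),
    (hf.1 x hx).conv.lim_add (conv_eps k), lim_eps]
  rfl

theorem contAt_iff (hf : M.IsFun f) (hx : M.InUnit x) : M.ContAt f x ↔ ∀ k, ∃ N, ∀ y, M.InUnit y →
    |M.toR x - M.toR y| < M.epsR N → |M.valR f x - M.valR f y| < M.epsR k := by
  refine forall_congr' fun k => exists_congr fun N => forall₂_congr fun y hy => ?_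
  rw [close_iff hx.1 hy.1, close_iff (hf.1 x hx) (hf.1 y hy)]

theorem exists_add_epsR_lt {a b : M.R} (h : a < b) : ∃ l, a + M.epsR l < b := by
  obtain ⟨l, hl⟩ := exists_epsR_lt (sub_pos.2 h)
  exact ⟨l, by linarith⟩

theorem exists_ball_subset (x y : M.D .one) {k : M.D .nat} (h : |M.toR x - M.toR y| < M.epsR k) :
    ∃ N, ∀ z, |M.toR y - M.toR z| < M.epsR N → |M.toR x - M.toR z| < M.epsR k := by
  obtain ⟨N, hN⟩ := exists_add_epsR_lt h
  refine ⟨N, fun z hz => ?_⟩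
  have := abs_sub_le (M.toR x) (M.toR y) (M.toR z)
  linarith

/-- Lower bounds on rational points are lower bounds. -/
theorem Usco.le_of_rat (hf : M.Usco f) {N : M.D .nat} {r : M.R}
    (h : ∀ c, M.InUnit (M.ratReal c) → |M.toR x - M.toR (M.ratReal c)| < M.epsR N →
      r ≤ M.valR f (M.ratReal c)) (hy : M.InUnit y) (hxy : |M.toR x - M.toR y| < M.epsR N) :
    r ≤ M.valR f y := by
  -- A value below `r` at `y` would, by upper semi-continuity at `y`, persist at nearby rational
  -- points.
  by_contra! hlt
  obtain ⟨l, hl⟩ := exists_add_epsR_lt hlt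
  obtain ⟨N₁, h₁⟩ := exists_ball_subset x y hxy
  obtain ⟨N₂, h₂⟩ := (usco_iff hf.1).1 hf y hy l
  obtain ⟨c, hc, hyc⟩ := exists_unit_rat_close hy (N₁ + N₂)
  have h3 := h c hc (h₁ _ (hyc.trans_le (epsR_add_le _ _)))
  have h4 := h₂ _ hc (hyc.trans_le (add_comm N₁ N₂ ▸ epsR_add_le _ _))
  linarith

/-! ### Dense open sets whose common points are points of continuity. -/

/-- At `x`, the oscillation of `f` is less than `2 ^ (-n)`, as witnessed by rational points. -/
def SmallOsc (f : M.D (.one ⟶ₜ .one)) (n : M.D .nat) (x : M.D .one) : Prop :=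
  ∃ N l, ∀ c, M.InUnit (M.ratReal c) → M.Close x (M.ratReal c) N →
    M.RLe (M.val (M.app f x) + M.cst (M.eps l))
      (M.val (M.app f (M.ratReal c)) + M.cst (M.eps n))

theorem smallOsc_iff (hf : M.IsFun f) (hx : M.InUnit x) {n : M.D .nat} :
    SmallOsc f n x ↔ ∃ N l, ∀ c, M.InUnit (M.ratReal c) →
      |M.toR x - M.toR (M.ratReal c)| < M.epsR N →
      M.valR f x + M.epsR l ≤ M.valR f (M.ratReal c) + M.epsR n := by
  refine exists_congr fun N => exists_congr fun l => forall₂_congr fun c hc => ?_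
  rw [close_iff hx.1 hc.1, ((hf.1 x hx).conv.add (conv_eps l)).rle_iff
    ((hf.1 _ hc).conv.add (conv_eps n)), (hf.1 x hx).conv.lim_add (conv_eps l),
    (hf.1 _ hc).conv.lim_add (conv_eps n), lim_eps, lim_eps]
  rfl

variable (f) in
/-- The sets used for finding points of continuity. -/
def ContApprox (n : M.D .nat) (x : M.D .one) : Prop :=
  M.RLt (M.val (M.app f x)) (M.cst (negNat n)) ∨ SmallOsc f n x

theorem contApprox_iff (hf : M.IsFun f) (hx : M.InUnit x) {n : M.D .nat} :
    ContApprox f n x ↔ M.valR f x < -natR n ∨ ∃ N l, ∀ c, M.InUnit (M.ratReal c) →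
      |M.toR x - M.toR (M.ratReal c)| < M.epsR N →
      M.valR f x + M.epsR l ≤ M.valR f (M.ratReal c) + M.epsR n := by
  rw [ContApprox, smallOsc_iff hf hx, (hf.1 x hx).conv.rlt_iff (conv_negNat n), lim_negNat]
  rfl

/-- The points `c` range over codes of rationals instead of all reals, so only number quantifiers
occur and the sets exist in the model. -/
theorem arith_contApprox : Arith (M := M) (Γ := [.one, .nat]) fun e => ContApprox f e.2.1 e.1 := by
  refine Arith.or (Arith.rlt (.val (.app (.const f) .var₀))
    (.cst (.const 0) .var₁ (.const 1))) ?_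
  refine Arith.ex (Arith.ex (Arith.all ?_))
  have hr : IsTerm (M := M) (Γ := [.nat, .nat, .nat, .one, .nat]) fun e => M.ratReal e.1 :=
    .ratReal .var₀
  exact (Arith.inUnit hr).imp ((Arith.close .var₃ hr .var₂).imp
    (.rle ((IsSeqTerm.val (.app (.const f) .var₃)).add (.eps .var₁))
      ((IsSeqTerm.val (.app (.const f) hr)).add (.eps .var₄))))

/-- Sequences of sets given by arithmetical predicates. -/
theorem Arith.exists_sets {P : M.D .nat → M.D .one → Prop}
    (hP : Arith (Γ := [.one, .nat]) fun e => P e.2.1 e.1) : ∃ O : M.D (.nat ⟶ₜ .two),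
      ∀ n x, (M.app (M.app O n) x = 0 ∨ M.app (M.app O n) x = 1) ∧
        (M.app (M.app O n) x = 1 ↔ P n x) := by
  obtain ⟨F, hF, h⟩ := hP
  obtain ⟨G, hG, e₁⟩ := hF.exists_lam rca
  obtain ⟨H, -, e₂⟩ := hG.exists_lam rca
  refine ⟨H PUnit.unit, fun n x => ?_⟩
  rw [show M.app (M.app (H PUnit.unit) n) x = F (x, n, PUnit.unit) from
    (e₂ PUnit.unit n x).trans (e₁ (n, PUnit.unit) x)]
  exact ⟨(h _).1, (h _).2.symm⟩

/-- If `f` is not below `-n` somewhere in the ball, it is bounded below there. The infimum over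
rational points is then located on the grid `-n + j * 2 ^ (-(n + 1))` by taking the least `j` whose
grid value is undercut. -/
theorem dense_contApprox (hf : M.Usco f) (n k : M.D .nat) {b : M.D .one} (hb : M.InUnit b) :
    ∃ a, M.InUnit a ∧ ContApprox f n a ∧ |M.toR b - M.toR a| < M.epsR k := by
  by_cases hlow : ∃ a, M.InUnit a ∧ |M.toR b - M.toR a| < M.epsR k ∧ M.valR f a < -natR n
  · obtain ⟨a, ha, hab, h⟩ := hlow
    exact ⟨a, ha, (contApprox_iff hf.1 ha).2 (.inl h), hab⟩
  push Not at hlow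
  let P : M.D .nat → Prop := fun j => ∃ c, M.InUnit (M.ratReal c) ∧ M.Close b (M.ratReal c) k ∧
    M.RLt (M.val (M.app f (M.ratReal c)))
      (M.cst ⟨j, n * M.pow2 (n + 1), M.pow2 (n + 1)⟩)
  have hP : Arith (Γ := [.nat]) fun e => P e.1 := by
    refine Arith.ex ?_
    have hr : IsTerm (M := M) (Γ := [.nat, .nat]) fun e => M.ratReal e.1 := .ratReal .var₀
    exact (Arith.inUnit hr).and ((Arith.close (.const b) hr (.const k)).and
      (.rlt (.val (.app (.const f) hr)) (.cst .var₁ (.const _) (.const _))))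
  have hlim : ∀ j, lim (M.cst ⟨j, n * M.pow2 (n + 1), M.pow2 (n + 1)⟩) =
      natR j * M.epsR (n + 1) - natR n := by
    intro j
    rw [lim_cst (pow2_pos (n + 1)), Frac.toQ_eq (pow2_pos _), natR, natR, epsR, epsQ_eq, ← map_mul,
      ← map_sub, FracDiff.mk_mul_mk, FracDiff.mk_sub_mk]
    congr 1
    rw [FracDiff.mk_eq_mk]
    ring
  have hPiff : ∀ j, P j ↔ ∃ c, M.InUnit (M.ratReal c) ∧
      |M.toR b - M.toR (M.ratReal c)| < M.epsR k ∧
      M.valR f (M.ratReal c) < natR j * M.epsR (n + 1) - natR n := by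
    intro j
    refine exists_congr fun c => and_congr_right fun hc => ?_
    rw [close_iff hb.1 hc.1, (hf.1.1 _ hc).conv.rlt_iff (conv_cst (pow2_pos (n + 1))), hlim]
    rfl
  obtain ⟨j, hj, hmin⟩ := hP.exists_least (P := P) (by
    obtain ⟨c, hc, hbc⟩ := exists_unit_rat_close hb k
    obtain ⟨J, hJ⟩ := (hf.1.1 _ hc).exists_abs_lt
    -- This makes the grid value equal to `J`, a bound for `f` at the rational point `c`.
    refine ⟨(J + n) * M.pow2 (n + 1), (hPiff _).2 ⟨c, hc, hbc, ?_⟩⟩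
    have h1 := epsR_mul_pow2 (M := M) (n + 1)
    rw [natR_mul, natR_add, mul_assoc, mul_comm (natR (M.pow2 _)), h1]
    have := (abs_lt.1 hJ).2
    linarith)
  obtain ⟨c, hc, hbc, hlt⟩ := (hPiff j).1 hj
  refine ⟨M.ratReal c, hc, (contApprox_iff hf.1 hc).2 (.inr ?_), hbc⟩
  rcases eq_zero_or_eq_add_one j with rfl | ⟨j, rfl⟩
  · have := hlow _ hc hbc
    rw [natR_zero] at hlt
    linarith
  obtain ⟨N, hN⟩ := exists_ball_subset b (M.ratReal c) hbc
  -- The value at `c` is below grid point `j + 1` and values at nearby rationals are not below grid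
  -- point `j`. The difference is thus less than one mesh `2 ^ (-(n + 1))`, and a second mesh is the
  -- margin.
  refine ⟨N, n + 1, fun c' hc' hcc' => ?_⟩
  have h1 : ¬ P j := hmin j (lt_add_one j)
  rw [hPiff] at h1
  push Not at h1
  have h2 := h1 c' hc' (hN _ hcc')
  have h3 := epsR_add_self n
  rw [natR_add, natR_one, add_mul, one_mul] at hlt
  linarith

theorem open_contApprox (hf : M.Usco f) (n : M.D .nat) (hx : M.InUnit x) (h : ContApprox f n x) :
    ∃ k, ∀ y, M.InUnit y → |M.toR x - M.toR y| < M.epsR k → ContApprox f n y := by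
  rcases (contApprox_iff hf.1 hx).1 h with h | ⟨N, l, h⟩
  · obtain ⟨l, hl⟩ := exists_add_epsR_lt h
    obtain ⟨k, hk⟩ := (usco_iff hf.1).1 hf x hx l
    exact ⟨k, fun y hy hxy => (contApprox_iff hf.1 hy).2 (.inl ((hk y hy hxy).trans hl))⟩
  -- The margin `2 ^ (-l)` is there for this purpose: half of it absorbs the increase of `f` from
  -- `x` to `y`, the other half is the margin at `y`.
  · obtain ⟨k, hk⟩ := (usco_iff hf.1).1 hf x hx (l + 1)
    refine ⟨k + N, fun y hy hxy => (contApprox_iff hf.1 hy).2 (.inr ?_)⟩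
    obtain ⟨N', hN'⟩ := exists_ball_subset x y (hxy.trans_le (add_comm k N ▸ epsR_add_le N k))
    refine ⟨N', l + 1, fun c hc hyc => ?_⟩
    have h1 := h c hc (hN' _ hyc)
    have h2 := hk y hy (hxy.trans_le (epsR_add_le _ _))
    have h3 := epsR_add_self l
    linarith

theorem ContApprox.mono (hf : M.Usco f) {n : M.D .nat} (hx : M.InUnit x)
    (h : ContApprox f (n + 1) x) : ContApprox f n x := by
  rw [contApprox_iff hf.1 hx] at h ⊢
  rcases h with h | ⟨N, l, h⟩
  · refine .inl (h.trans_le ?_)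
    rw [natR_add, natR_one]
    linarith
  · refine .inr ⟨N, l, fun c hc hxc => (h c hc hxc).trans ?_⟩
    have := epsR_add_le n 1
    linarith

theorem ContApprox.contAt (hf : M.Usco f) (hx : M.InUnit x) (h : ∀ n, ContApprox f n x) :
    M.ContAt f x := by
  rw [contAt_iff hf.1 hx]
  intro k
  obtain ⟨n, hn⟩ := (hf.1.1 x hx).exists_abs_lt
  -- The index `k + n` is large enough both to exclude `f(x) < -(k + n)`, as `|f(x)| < n`, and to
  -- give precision `2 ^ (-k)`.
  rcases (contApprox_iff hf.1 hx).1 (h (k + n)) with h1 | ⟨N, l, h1⟩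
  · have h2 := (abs_lt.1 hn).1
    have h3 := natR_nonneg k
    rw [natR_add] at h1
    linarith
  · obtain ⟨N', hN'⟩ := (usco_iff hf.1).1 hf x hx k
    refine ⟨N + N', fun y hy hxy => ?_⟩
    have h2 : M.valR f x - M.epsR (k + n) + M.epsR l ≤ M.valR f y :=
      hf.le_of_rat (x := x) (N := N) (fun c hc hxc => by
        have := h1 c hc hxc
        linarith) hy (hxy.trans_le (epsR_add_le _ _))
    have h3 := hN' y hy (hxy.trans_le (add_comm N N' ▸ epsR_add_le _ _))
    have h4 := epsR_add_le k n
    have h5 := epsR_pos l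
    exact abs_lt.2 ⟨by linarith, by linarith⟩

theorem ContApprox.congr (hf : M.IsFun f) {n : M.D .nat} (hx : M.InUnit x) (hy : M.InUnit y)
    (hxy : M.RealEq x y) : ContApprox f n x ↔ ContApprox f n y := by
  rw [contApprox_iff hf hx, contApprox_iff hf hy, valR, valR,
    (realEq_iff hx.1 hy.1).1 hxy, (realEq_iff (hf.1 x hx) (hf.1 y hy)).1 (hf.2 x y hx hy hxy)]

theorem eq_of_eq_one_iff {a b : M.D .nat} (ha : a = 0 ∨ a = 1) (hb : b = 0 ∨ b = 1)
    (h : a = 1 ↔ b = 1) : a = b := by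
  have := zero_ne_one (M := M)
  rcases ha with rfl | rfl <;> rcases hb with rfl | rfl <;> simp_all

theorem BCT.uscoContPoint (h : M.BCT) : M.UscoContPoint := by
  intro f hf
  obtain ⟨O, hO⟩ := Arith.exists_sets (P := ContApprox f) arith_contApprox
  obtain ⟨x, hx⟩ := h O
    (fun n => ⟨fun x _ => (hO n x).1, fun x y hx hy hxy =>
      eq_of_eq_one_iff (hO n x).1 (hO n y).1
        ((hO n x).2.trans ((ContApprox.congr hf.1 hx hy hxy).trans (hO n y).2.symm))⟩)
    (fun n x hx => ⟨hx.1, (hO n x).2.2 (ContApprox.mono hf hx.1 ((hO _ x).2.1 hx.2))⟩)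
    (fun n x hx => by
      obtain ⟨k, hk⟩ := open_contApprox hf n hx.1 ((hO n x).2.1 hx.2)
      exact ⟨k, fun y hy hxy => ⟨hy, (hO n y).2.2 (hk y hy ((close_iff hx.1.1 hy.1).1 hxy))⟩⟩)
    (fun n k b hb => by
      obtain ⟨a, ha, h1, h2⟩ := dense_contApprox hf n k hb
      refine ⟨a, ⟨ha, (hO n a).2.2 h1⟩, (close_iff ha.1 hb.1).2 ?_⟩
      rwa [abs_sub_comm])
  exact ⟨x, (hx 0).1, ContApprox.contAt hf (hx 0).1 fun n => (hO n x).2.1 (hx n).2⟩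

end Usco

end HigherOrderArithmetic.Structure

namespace HigherOrderArithmetic.Structure

variable {M : Structure.{u}} [hM : Fact M.ModelsACA0ω]

/-! ## Consequences of the existence of points of continuity -/

section Forward

theorem UscoContPoint.uscoBoundedBelow (h : M.UscoContPoint) : M.UscoBoundedBelow := by
  intro f hf
  obtain ⟨x, hx, hc⟩ := h f hf
  obtain ⟨N, hN⟩ := (contAt_iff hf.1 hx).1 hc 0
  obtain ⟨c, d, hc, hd, hcd, hint⟩ := exists_interval hx N
  obtain ⟨n, hn⟩ := (hf.1.1 x hx).exists_abs_lt
  obtain ⟨q, hq⟩ := Frac.exists_decode_toQ (-FracDiff.mk n 0 1 one_pos - M.epsQ 0)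
  refine ⟨q, c, d, hc, hd, (hc.1.conv.rlt_iff hd.1.conv).2 hcd, fun y hy hcy hyd => ?_⟩
  rw [hc.1.conv.rlt_iff hy.1.conv] at hcy
  rw [hy.1.conv.rlt_iff hd.1.conv] at hyd
  rw [(conv_cst (decode_den_pos q)).rle_iff (hf.1.1 y hy).conv, lim_cst (decode_den_pos q), hq,
    map_sub, map_neg]
  change -natR n - M.epsR 0 ≤ M.valR f y
  have h1 := (abs_lt.1 hn).1
  have h2 := (abs_lt.1 (hN y hy (hint y hy hcy.le hyd.le))).2
  change _ < M.valR f x at h1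
  linarith

theorem UscoContPoint.uscoPositiveInf (h : M.UscoContPoint) : M.UscoPositiveInf := by
  intro f hf hpos
  obtain ⟨x, hx, hc⟩ := h f hf
  have h0 := hpos x hx
  have e0 : (0 : M.Frac).toQ = 0 := Frac.toQ_eq one_pos
  rw [(conv_cst (r := 0) one_pos).rlt_iff (hf.1.1 x hx).conv, lim_cst (r := 0) one_pos, e0,
    map_zero] at h0
  obtain ⟨l, hl⟩ := exists_epsR_lt h0
  obtain ⟨N, hN⟩ := (contAt_iff hf.1 hx).1 hc (l + 1)
  obtain ⟨c, d, hc, hd, hcd, hint⟩ := exists_interval hx N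
  refine ⟨c, d, hc, hd, (hc.1.conv.rlt_iff hd.1.conv).2 hcd, l + 1, fun y hy hcy hyd => ?_⟩
  rw [hc.1.conv.rle_iff hy.1.conv] at hcy
  rw [hy.1.conv.rle_iff hd.1.conv] at hyd
  rw [(conv_eps _).rle_iff (hf.1.1 y hy).conv, lim_eps]
  change _ ≤ M.valR f y
  change _ < M.valR f x at hl
  have h2 := (abs_lt.1 (hN y hy (hint y hy hcy hyd))).2
  have h3 := epsR_add_self l
  linarith

end Forward

/-! ## Functions constructed from a failure of the Baire category theorem -/

/-- A function from `[0,1]` to the numbers which is lower semi-continuous and unbounded on every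
interval. -/
structure IsLevel (h : M.D .two) : Prop where
  congr : ∀ x y, M.InUnit x → M.InUnit y → M.toR x = M.toR y → M.app h x = M.app h y
  lsc : ∀ x, M.InUnit x → ∃ k, ∀ y, M.InUnit y → |M.toR x - M.toR y| < M.epsR k →
    M.app h x ≤ M.app h y
  unbounded : ∀ n k b, M.InUnit b → ∃ a, M.InUnit a ∧ |M.toR b - M.toR a| < M.epsR k ∧
    n < M.app h a

/-- The number of steps may be nonstandard, so passing from one step to many uses induction inside
the model; it applies because membership of a fixed point is arithmetical in the index. -/
theorem mem_of_le {O : M.D (.nat ⟶ₜ .two)}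
    (hdec : ∀ n x, M.Mem x (M.app O (n + 1)) → M.Mem x (M.app O n)) {x : M.D .one}
    {n i : M.D .nat} : M.Mem x (M.app O (n + i)) → M.Mem x (M.app O n) :=
  Arith.induction (P := fun i => M.Mem x (M.app O (n + i)) → M.Mem x (M.app O n))
    (by
      have h1 : ∀ k : M.Env [.nat] → M.D .nat, IsTerm k →
          Arith fun e => M.Mem x (M.app O (k e)) := fun k hk =>
        (Arith.inUnit (.const x)).and (.eq (.app (.app (.const O) hk) (.const x)) (.const 1))
      exact (h1 _ (.add (.const n) .var₀)).imp (h1 _ (.const n)))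
    (fun h => by rwa [add_zero] at h)
    (fun i ih h => ih (hdec _ _ (by rwa [← add_assoc] at h))) i

/-- The level of `x` is the least `n` with `x ∉ O_n`. Since the sets decrease, `x ∈ O_m` exactly
when `m` is below the level; openness then gives lower semi-continuity and density gives
unboundedness. -/
theorem exists_isLevel (h : ¬ M.BCT) : ∃ h : M.D .two, IsLevel h := by
  unfold BCT at h
  push Not at h
  obtain ⟨O, hsub, hdec, hopen, hdense, hne⟩ := h
  obtain ⟨h, hh⟩ := Arith.exists_choice (M := M)
    (P := fun n x => (M.app (M.app O n) x ≠ 1 ∧ ∀ m, m < n → M.app (M.app O m) x = 1) ∨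
      -- Choice needs a value at every type `1` object. Outside `[0,1]` all characteristic functions
      -- may take the value `1`, and then any number will do.
      ∀ m, M.app (M.app O m) x = 1)
    (((Arith.eq (.app (.app (.const O) .var₀) .var₁) (.const 1)).not.and
      (by
        refine Arith.all ?_
        exact (Arith.lt .var₀ .var₁).imp (.eq (.app (.app (.const O) .var₀) .var₂) (.const 1)))).or
      (by
        refine Arith.all ?_
        exact .eq (.app (.app (.const O) .var₀) .var₂) (.const 1)))
    (fun x => by
      by_cases hx : ∀ m, M.app (M.app O m) x = 1
      · exact ⟨0, .inr hx⟩
      · push Not at hx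
        obtain ⟨n, hn, hmin⟩ := Arith.exists_least (P := fun n => M.app (M.app O n) x ≠ 1)
          (Arith.eq (.app (.app (.const O) .var₀) (.const x)) (.const 1)).not hx
        exact ⟨n, .inl ⟨hn, fun m hm => not_not.1 (hmin m hm)⟩⟩)
  have key : ∀ x, M.InUnit x → ∀ m, M.Mem x (M.app O m) ↔ m < M.app h x := by
    intro x hx m
    rcases hh x with ⟨h1, h2⟩ | h1
    · refine ⟨fun hm => ?_, fun hm => ⟨hx, h2 m hm⟩⟩
      by_contra! hle
      obtain ⟨i, rfl⟩ := le_iff_exists_add.1 hle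
      exact h1 (mem_of_le hdec hm).2
    · obtain ⟨n, hn⟩ := hne x
      exact absurd ⟨hx, h1 n⟩ hn
  refine ⟨h, fun x y hx hy hxy => ?_, fun x hx => ?_, fun n k b hb => ?_⟩
  · have h1 : ∀ m, m < M.app h x ↔ m < M.app h y := fun m => by
      rw [← key x hx, ← key y hy, Mem, Mem,
        (hsub m).2 x y hx hy ((realEq_iff hx.1 hy.1).2 hxy)]
      simp [hx, hy]
    exact le_antisymm (not_lt.1 fun hlt => lt_irrefl _ ((h1 _).1 hlt))
      (not_lt.1 fun hlt => lt_irrefl _ ((h1 _).2 hlt))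
  · rcases eq_zero_or_eq_add_one (M.app h x) with h0 | ⟨m, hm⟩
    · exact ⟨0, fun y _ _ => h0 ▸ nat_nonneg _⟩
    · obtain ⟨k, hk⟩ := hopen m x ((key x hx m).2 (hm ▸ lt_add_one m))
      refine ⟨k, fun y hy hxy => ?_⟩
      rw [hm, add_one_le_iff, ← key y hy]
      exact hk y hy ((close_iff hx.1 hy.1).2 hxy)
  · obtain ⟨a, ha, hab⟩ := hdense n k b hb
    refine ⟨a, ha.1, ?_, (key a ha.1 n).1 ha⟩
    rw [abs_sub_comm]
    exact (close_iff ha.1.1 hb.1).1 hab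

/-- Sequences of codes of given rationals. -/
theorem exists_codes_seq {p n d : M.D .nat → M.D .nat} (hp : IsTerm (Γ := [.nat]) fun e => p e.1)
    (hn : IsTerm (Γ := [.nat]) fun e => n e.1) (hd : IsTerm (Γ := [.nat]) fun e => d e.1)
    (hpos : ∀ k, 0 < d k) : ∃ φ : M.D .one, ∀ k,
      (M.decode (M.app φ k)).toQ = FracDiff.mk (p k) (n k) (d k) (hpos k) := by
  obtain ⟨P, N, D, h⟩ := exists_decode_term (M := M)
  obtain ⟨φ, hφ⟩ := Arith.exists_choice_nat (M := M)
    (P := fun c k => M.app D c = d k ∧ M.app P c + n k = p k + M.app N c)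
    ((Arith.eq (.app (.const D) .var₀) hd.weaken).and
      (.eq ((IsTerm.app (.const P) .var₀).add hn.weaken)
        (hp.weaken.add (.app (.const N) .var₀))))
    (fun k => by
      obtain ⟨c, hc⟩ := exists_decode_eq (p k) (n k) (d k) (hpos k)
      rw [h] at hc
      exact ⟨c, hc⟩)
  refine ⟨φ, fun k => ?_⟩
  obtain ⟨h1, h2⟩ := hφ k
  rw [Frac.toQ, dif_pos (decode_den_pos _), FracDiff.mk_eq_mk, h, h1]
  linear_combination (d k) * h2

/-- The functions `x ↦ φ(h(x))`, for a sequence `φ` of codes of rationals. -/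
theorem exists_step (h : M.D .two) (φ : M.D .one) : ∃ f : M.D (.one ⟶ₜ .one), ∀ x,
    M.val (M.app f x) = M.cst (M.decode (M.app φ (M.app h x))) := by
  obtain ⟨G, hG, e₁⟩ := IsTerm.exists_lam (M := M) (Γ := [.one]) (σ := .nat) rca
    (F := fun e => M.app φ (M.app h e.2.1)) (.app (.const φ) (.app (.const h) .var₁))
  obtain ⟨H, -, e₂⟩ := hG.exists_lam rca
  refine ⟨H PUnit.unit, fun x => funext fun n => congrArg M.decode ?_⟩
  exact (e₂ PUnit.unit x n).trans (e₁ (x, PUnit.unit) n)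

/-! ### Functions of the level. -/

section Step

variable {h : M.D .two} {f : M.D (.one ⟶ₜ .one)} {v : M.D .nat → M.R}

/-- `f` is the function `x ↦ v(h(x))`. -/
def IsStep (h : M.D .two) (v : M.D .nat → M.R) (f : M.D (.one ⟶ₜ .one)) : Prop :=
  ∀ x, M.IsReal (M.app f x) ∧ M.valR f x = v (M.app h x)

theorem exists_isStep (h : M.D .two) {p n d : M.D .nat → M.D .nat}
    (hp : IsTerm (Γ := [.nat]) fun e => p e.1)
    (hn : IsTerm (Γ := [.nat]) fun e => n e.1) (hd : IsTerm (Γ := [.nat]) fun e => d e.1)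
    (hpos : ∀ k, 0 < d k) :
    ∃ f, IsStep h (fun k => ofQ (FracDiff.mk (p k) (n k) (d k) (hpos k))) f := by
  obtain ⟨φ, hφ⟩ := exists_codes_seq hp hn hd hpos
  obtain ⟨f, hf⟩ := exists_step h φ
  exact ⟨f, fun x => ⟨isReal_of_val_eq_cst (hf x), (toR_of_val_eq_cst (hf x)).trans (congrArg ofQ (hφ _))⟩⟩

theorem exists_isStep_epsR (h : M.D .two) : ∃ f, IsStep h M.epsR f := by
  obtain ⟨f, hf⟩ := exists_isStep h (p := fun _ => 1) (n := fun _ => 0) (d := M.pow2)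
    (.const 1) (.const 0) (.pow2 .var₀) pow2_pos
  exact ⟨f, fun x => ⟨(hf x).1, by rw [(hf x).2, epsR, epsQ_eq]⟩⟩

theorem exists_isStep_neg (h : M.D .two) : ∃ f, IsStep h (fun n => -natR n) f := by
  obtain ⟨f, hf⟩ := exists_isStep h (p := fun _ => 0) (n := fun n => n) (d := fun _ => 1)
    (.const 0) .var₀ (.const 1) (fun _ => one_pos)
  exact ⟨f, fun x => ⟨(hf x).1, (hf x).2.trans (map_neg ofQ (FracDiff.mk _ 0 1 one_pos))⟩⟩

theorem IsLevel.isFun (hh : IsLevel h) (hf : IsStep h v f) : M.IsFun f :=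
  ⟨fun x _ => (hf x).1, fun x y hx hy hxy => (realEq_iff (hf x).1 (hf y).1).2 (by
    have := hh.congr x y hx hy ((realEq_iff hx.1 hy.1).1 hxy)
    exact (hf x).2.trans (this ▸ (hf y).2.symm))⟩

/-- Near `x` the level does not drop below its value at `x`, so an antitone function of it does not
rise. -/
theorem IsLevel.usco (hh : IsLevel h) (hf : IsStep h v f) (hv : Antitone v) : M.Usco f := by
  rw [usco_iff (hh.isFun hf)]
  intro x hx k
  obtain ⟨N, hN⟩ := hh.lsc x hx
  refine ⟨N, fun y hy hxy => ?_⟩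
  rw [(hf x).2, (hf y).2]
  exact (hv (hN y hy hxy)).trans_lt (lt_add_of_pos_right _ (epsR_pos k))

theorem epsR_antitone : Antitone M.epsR := fun _ _ => epsR_le_of_le

theorem epsR_succ_lt (n : M.D .nat) : M.epsR (n + 1) < M.epsR n := by
  have h1 := epsR_add_self n
  have h2 := epsR_pos (n + 1)
  linarith

/-- Every ball around `x` contains a point of higher level, where `f` is at most half of its value
at `x`. -/
theorem IsLevel.not_hasContPoint (hh : IsLevel h) (hf : IsStep h M.epsR f) :
    ¬ M.HasContPoint f := by
  rintro ⟨x, hx, hc⟩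
  obtain ⟨N, hN⟩ := (contAt_iff (hh.isFun hf) hx).1 hc (M.app h x + 1)
  obtain ⟨a, ha, hxa, hlt⟩ := hh.unbounded (M.app h x) N x hx
  have h1 := (abs_lt.1 (hN a ha hxa)).2
  rw [(hf x).2, (hf a).2] at h1
  have h2 := epsR_antitone (add_one_le_iff.2 hlt)
  have h3 := epsR_add_self (M.app h x)
  linarith

/-- On small balls around `x` the supremum is `f(x)`, attained at `x`, and the infimum is `0`
because levels are unbounded. -/
theorem IsLevel.isOscFun (hh : IsLevel h) (hf : IsStep h M.epsR f) : M.IsOscFun f f := by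
  refine ⟨hh.isFun hf, fun x hx l => ?_⟩
  obtain ⟨K, hK⟩ := hh.lsc x hx
  refine ⟨K, fun i => ⟨?_, ?_⟩⟩
  -- Level above `l + 1` makes `f(a)` strictly smaller than `2 ^ (-l)`.
  · obtain ⟨a, ha, hxa, hlt⟩ := hh.unbounded (l + 1) (K + i) x hx
    refine ⟨x, a, hx, ha, (close_iff hx.1 hx.1).2 ?_, (close_iff hx.1 ha.1).2 hxa, ?_⟩
    · rw [sub_self, abs_zero]
      exact epsR_pos _
    · rw [((hf x).1.conv.sub (conv_eps l)).rlt_iff ((hf x).1.conv.sub (hf a).1.conv),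
        (hf x).1.conv.lim_sub (conv_eps l), (hf x).1.conv.lim_sub (hf a).1.conv, lim_eps]
      change _ < _ - M.valR f a
      rw [(hf a).2]
      have h1 := epsR_antitone hlt.le
      have h2 := epsR_succ_lt l
      change M.valR f x - _ < M.valR f x - _
      linarith
  · rintro ⟨u, w, hu, hw, hxu, -, hlt⟩
    rw [((hf x).1.conv.add (conv_eps l)).rlt_iff ((hf u).1.conv.sub (hf w).1.conv),
      (hf x).1.conv.lim_add (conv_eps l), (hf u).1.conv.lim_sub (hf w).1.conv, lim_eps] at hlt
    change M.valR f x + _ < M.valR f u - M.valR f w at hlt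
    rw [(hf x).2, (hf u).2, (hf w).2] at hlt
    have h1 := epsR_antitone
      (hK u hu (((close_iff hx.1 hu.1).1 hxu).trans_le (epsR_add_le K i)))
    have h2 := epsR_pos l
    have h3 := epsR_pos (M.app h w)
    linarith

/-- The level sets cover `[0,1]` and `f` is constant on each, so any radius works. -/
theorem IsLevel.countablyCont (hh : IsLevel h) (hf : IsStep h v f) : M.CountablyCont f := by
  obtain ⟨E, hE⟩ := Arith.exists_sets (M := M) (P := fun n x => M.app h x = n)
    (.eq (.app (.const h) .var₀) .var₁)
  refine ⟨E, fun n => ⟨fun x _ => (hE n x).1, fun x y hx hy hxy => ?_⟩,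
    fun x hx => ⟨M.app h x, hx, (hE _ x).2.2 rfl⟩, fun m x hx k => ⟨0, fun y hy _ => ?_⟩⟩
  · refine eq_of_eq_one_iff (hE n x).1 (hE n y).1 ?_
    rw [(hE n x).2, (hE n y).2, hh.congr x y hx hy ((realEq_iff hx.1 hy.1).1 hxy)]
  · rw [close_iff (hf x).1 (hf y).1]
    change |M.valR f x - M.valR f y| < _
    rw [(hf x).2, (hf y).2, (hE m x).2.1 hx.2, (hE m y).2.1 hy.2, sub_self, abs_zero]
    exact epsR_pos k

theorem IsLevel.exists_lt_of_lt (hh : IsLevel h) {c d : M.D .one} (hc : M.InUnit c)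
    (hd : M.InUnit d) (hcd : M.RLt (M.val c) (M.val d)) (n : M.D .nat) :
    ∃ a, M.InUnit a ∧ M.RLt (M.val c) (M.val a) ∧ M.RLt (M.val a) (M.val d) ∧ n < M.app h a := by
  obtain ⟨b, k, hb, hball⟩ := exists_ball hc hd ((hc.1.conv.rlt_iff hd.1.conv).1 hcd)
  obtain ⟨a, ha, hab, hlt⟩ := hh.unbounded n k b hb
  obtain ⟨h1, h2⟩ := hball a ha (by rwa [abs_sub_comm])
  exact ⟨a, ha, (hc.1.conv.rlt_iff ha.1.conv).2 h1, (ha.1.conv.rlt_iff hd.1.conv).2 h2, hlt⟩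

end Step

/-! ### The Baire category theorem from each of the weaker principles. -/

theorem UscoOwnOscContPoint.bct (H : M.UscoOwnOscContPoint) : M.BCT := by
  by_contra hB
  obtain ⟨h, hh⟩ := exists_isLevel hB
  obtain ⟨f, hf⟩ := exists_isStep_epsR h
  exact hh.not_hasContPoint hf (H f (hh.usco hf epsR_antitone) (hh.isOscFun hf))

theorem UscoCountablyContPoint.bct (H : M.UscoCountablyContPoint) : M.BCT := by
  by_contra hB
  obtain ⟨h, hh⟩ := exists_isLevel hB
  obtain ⟨f, hf⟩ := exists_isStep_epsR h
  exact hh.not_hasContPoint hf (H f (hh.usco hf epsR_antitone) (hh.countablyCont hf))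

/-- Here `2^(-h)` is of no use, being bounded below by `0`; the counterexample is `-h`. -/
theorem UscoBoundedBelow.bct (H : M.UscoBoundedBelow) : M.BCT := by
  by_contra hB
  obtain ⟨h, hh⟩ := exists_isLevel hB
  obtain ⟨f, hf⟩ := exists_isStep_neg h
  obtain ⟨q, c, d, hc, hd, hcd, hle⟩ := H f (hh.usco hf fun m n hmn => neg_le_neg (natR_le.2 hmn))
  obtain ⟨n, hn⟩ := exists_lt_natR (-(M.decode q).toQ)
  obtain ⟨a, ha, hca, had, hlt⟩ := hh.exists_lt_of_lt hc hd hcd n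
  have h1 := hle a ha hca had
  rw [(conv_cst (decode_den_pos q)).rle_iff (hf a).1.conv, lim_cst (decode_den_pos q)] at h1
  change _ ≤ M.valR f a at h1
  rw [(hf a).2] at h1
  have h2 := natR_lt.2 hlt
  rw [map_neg] at hn
  linarith

theorem UscoPositiveInf.bct (H : M.UscoPositiveInf) : M.BCT := by
  by_contra hB
  obtain ⟨h, hh⟩ := exists_isLevel hB
  obtain ⟨f, hf⟩ := exists_isStep_epsR h
  have e0 : (0 : M.Frac).toQ = 0 := Frac.toQ_eq one_pos
  obtain ⟨c, d, hc, hd, hcd, l, hle⟩ := H f (hh.usco hf epsR_antitone) fun x _ => by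
    rw [(conv_cst (r := 0) one_pos).rlt_iff (hf x).1.conv, lim_cst (r := 0) one_pos, e0, map_zero]
    change _ < M.valR f x
    rw [(hf x).2]
    exact epsR_pos _
  obtain ⟨a, ha, hca, had, hlt⟩ := hh.exists_lt_of_lt hc hd hcd (l + 1)
  rw [hc.1.conv.rlt_iff ha.1.conv] at hca
  rw [ha.1.conv.rlt_iff hd.1.conv] at had
  have h1 := hle a ha ((hc.1.conv.rle_iff ha.1.conv).2 hca.le)
    ((ha.1.conv.rle_iff hd.1.conv).2 had.le)
  rw [(conv_eps l).rle_iff (hf a).1.conv, lim_eps] at h1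
  change _ ≤ M.valR f a at h1
  rw [(hf a).2] at h1
  have h2 := epsR_antitone hlt.le
  have h3 := epsR_succ_lt l
  linarith

end HigherOrderArithmetic.Structure

theorem theorem2p3 (M : HigherOrderArithmetic.Structure.{u}) (hM : M.ModelsACA0ω) :
    List.TFAE
      [M.BCT,
       M.UscoContPoint,
       M.UscoOscContPoint,
       M.UscoOwnOscContPoint,
       M.UscoCountablyContPoint,
       M.UscoBoundedBelow,
       M.UscoPositiveInf] := by
  have : Fact M.ModelsACA0ω := ⟨hM⟩
  tfae_have 1 → 2 := fun h => h.uscoContPoint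
  tfae_have 2 → 3 := fun h f hf _ => h f hf
  tfae_have 3 → 4 := fun h f hf hosc => h f hf ⟨f, hosc⟩
  tfae_have 4 → 1 := fun h => h.bct
  tfae_have 2 → 5 := fun h f hf _ => h f hf
  tfae_have 5 → 1 := fun h => h.bct
  tfae_have 2 → 6 := fun h => h.uscoBoundedBelow
  tfae_have 6 → 1 := fun h => h.bct
  tfae_have 2 → 7 := fun h => h.uscoPositiveInf
  tfae_have 7 → 1 := fun h => h.bct
  tfae_finish
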